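/- **Setting.** Let $-\infty\le\alpha<0$, $\mathcal I=(\alpha,+\infty)$, $r>0$, and let $\mu,\sigma:\mathcal I\to\mathbb R$ be Lipschitz and $C^1$ with Lipschitz derivatives, $\sigma>0$, such that $\alpha$ and $+\infty$ are natural boundaries (in Feller's sense) of the diffusion $dX_t=\mu(X_t)\,dt+\sigma(X_t)\,dB_t$. Write $\mathcal L u=\mu u'+\tfrac12\sigma^2u''$. Assume: * (Tipping point) A probability law on $\mathcal I$ has a density $f$ that is Lipschitz and positive on $[0,\overline y]$ and vanishes on $\mathcal I\setminus[0,\overline y]$, for some $\overline y>0$. Let $F$ be its distribution function; $f/F$ is non-increasing on $(0,\overline y]$. * (Drift) $\sup_{x\ge 0}\mu'(x)<r$, and $\mu$ is twice differentiable on $[0,\infty)$ with $\mu''\le 0$ there. * (Continuation value) $U$ is nonnegative, non-decreasing, concave and $C^2$ on $[0,\infty)$, $\mu(0)>rU(0)$, and for some $u^*\ge 0$: $U'\ge 1$ on $[0,u^*]$, $U'=1$ on $[u^*,\infty)$, and $\mathcal L U-rU>0$ on $[0,u^*)$. Let $\overline x>0$ be the point with $\mu-rU>0$ on $[0,\overline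 x)$ and $\mu-rU<0$ on $(\overline x,\infty)$. Let $\psi$ and $\phi$ be the positive increasing and the positive decreasing fundamental solution of $\mathcal L u=ru$ on $\mathcal I$ (unique up to positive factors, on which $E$ and $\eta$ below do not depend). Put $$D(x,m)=\psi'(x)\phi(m)-\phi'(x)\psi(m),\qquad N(x,m)=\phi(x)\psi(m)-\psi(x)\phi(m)+\frac{\mu(x)}r D(x,m)-D(x,x)U(m),$$ $$E(x,m)=\frac{f(m)/F(m)}{1-\mu'(x)/r}\cdot\frac{N(x,m)}{D(x,m)}.$$ For $m\in[0,\overline x]$ let $\eta(m)$ be the unique $x\in[0,\infty)$ with $N(x,m)=0$, and let $x^0=\eta(0)$. **Proposition.** There is exactly one map $b:[0,\overline x]\to[0,\overline x]$ that is continuous on $[0,\overline x]$ and $C^1$ on $(0,\overline x\wedge\overline y)$ and satisfies $$b(0)=x^0,\qquad b'(m)=E(b(m),m)\ \text{ for } m\in(0,\overline x\wedge\overline y),\qquad b(m)=b(\overline x\wedge\overline y)\ \text{ for } m\in[0,\overline x],\ m>\overline x\wedge\overline y .$$ This $b$ is non-decreasing and satisfies $b(m)\le\eta(m)$ for all $m\in[0,\overline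 x]$. Moreover $\overline m:=\min\{m\in[0,\overline x]: b(m)=m\}$ exists and belongs to $(0,\overline x)$, and $b'(\overline m)<1$. Here, if $\overline m\ne\overline y$, then $b$ is differentiable at $\overline m$; if $\overline m=\overline y$ (where $b$ may have a kink), then both one-sided derivatives of $b$ at $\overline m$ exist and both are smaller than $1$. -/

import Mathlib

open Set MeasureTheory

noncomputable section

namespace Tipping

/-- The state space `(α, +∞)`, with `α ∈ [-∞, +∞)`. -/
def stateSpace (α : EReal) : Set ℝ := {x : ℝ | α < (x : EReal)}

/-- Density of the scale function of `dX = μ(X) dt + σ(X) dB` (reference point `0`). -/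
def scaleDensity (μ σ : ℝ → ℝ) (x : ℝ) : ℝ :=
  Real.exp (-∫ y in (0 : ℝ)..x, 2 * μ y / σ y ^ 2)

/-- Density of the speed measure of `dX = μ(X) dt + σ(X) dB`. -/
def speedDensity (μ σ : ℝ → ℝ) (x : ℝ) : ℝ :=
  2 / (σ x ^ 2 * scaleDensity μ σ x)

/-- `+∞` is a natural boundary in Feller's classification: neither an exit nor an
entrance boundary, i.e. both iterated integrals diverge. -/
def NaturalAtTop (μ σ : ℝ → ℝ) : Prop :=
  (∫⁻ x in Ioi (0 : ℝ),
      ENNReal.ofReal (scaleDensity μ σ x * ∫ y in (0 : ℝ)..x, speedDensity μ σ y)) = ⊤ ∧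
  (∫⁻ x in Ioi (0 : ℝ),
      ENNReal.ofReal (speedDensity μ σ x * ∫ y in (0 : ℝ)..x, scaleDensity μ σ y)) = ⊤

/-- The lower end point `α < 0` is a natural boundary in Feller's classification. -/
def NaturalAtBot (α : EReal) (μ σ : ℝ → ℝ) : Prop :=
  (∫⁻ x in stateSpace α ∩ Iio 0,
      ENNReal.ofReal (scaleDensity μ σ x * ∫ y in x..(0 : ℝ), speedDensity μ σ y)) = ⊤ ∧
  (∫⁻ x in stateSpace α ∩ Iio 0,
      ENNReal.ofReal (speedDensity μ σ x * ∫ y in x..(0 : ℝ), scaleDensity μ σ y)) = ⊤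

/-- The data of the extraction problem with a tipping point, with its standing assumptions. -/
structure Model where
  /-- lower end point of the state space -/
  α : EReal
  /-- discount rate -/
  r : ℝ
  /-- drift -/
  μ : ℝ → ℝ
  /-- volatility -/
  σ : ℝ → ℝ
  /-- continuation value -/
  U : ℝ → ℝ
  /-- extraction threshold of the downgraded problem -/
  ustar : ℝ
  /-- law of the tipping point -/
  Q : Measure ℝ
  /-- density of the law of the tipping point -/
  f : ℝ → ℝ
  /-- upper end point of the support of the law of the tipping point -/
  ybar : ℝ
  -- the diffusion
  α_neg : α < 0
  r_pos : 0 < r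
  μ_lipschitz : ∃ K, LipschitzOnWith K μ (stateSpace α)
  σ_lipschitz : ∃ K, LipschitzOnWith K σ (stateSpace α)
  σ_pos : ∀ x ∈ stateSpace α, 0 < σ x
  natural_top : NaturalAtTop μ σ
  natural_bot : NaturalAtBot α μ σ
  -- the tipping point
  Q_prob : IsProbabilityMeasure Q
  Q_density : Q = (volume.restrict (stateSpace α)).withDensity (fun x => ENNReal.ofReal (f x))
  ybar_pos : 0 < ybar
  f_lipschitz : ∃ K, LipschitzOnWith K f (Icc 0 ybar)
  f_pos : ∀ x ∈ Icc 0 ybar, 0 < f x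
  f_zero : ∀ x ∈ stateSpace α \ Icc 0 ybar, f x = 0
  -- smoothness and growth of the coefficients
  μ_contDiff : ContDiffOn ℝ 1 μ (stateSpace α)
  σ_contDiff : ContDiffOn ℝ 1 σ (stateSpace α)
  deriv_μ_lipschitz : ∃ K, LipschitzOnWith K (deriv μ) (stateSpace α)
  deriv_σ_lipschitz : ∃ K, LipschitzOnWith K (deriv σ) (stateSpace α)
  μ_zero : r * U 0 < μ 0
  -- the supremum of `μ'` over `[0, ∞)` is smaller than `r`
  deriv_μ_lt : ∃ c < r, ∀ x, 0 ≤ x → deriv μ x ≤ c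
  -- the continuation value; derivatives at `0` are one-sided
  U_nonneg : ∀ x, 0 ≤ x → 0 ≤ U x
  U_mono : MonotoneOn U (Ici 0)
  U_concave : ConcaveOn ℝ (Ici 0) U
  U_contDiff : ContDiffOn ℝ 2 U (Ici 0)
  ustar_nonneg : 0 ≤ ustar
  one_le_deriv_U : ∀ m, 0 ≤ m → m ≤ ustar → 1 ≤ derivWithin U (Ici 0) m
  deriv_U_eq_one : ∀ m, ustar ≤ m → derivWithin U (Ici 0) m = 1
  generator_U_pos : ∀ m, 0 ≤ m → m < ustar →
    0 < μ m * derivWithin U (Ici 0) m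
        + σ m ^ 2 / 2 * iteratedDerivWithin 2 U (Ici 0) m - r * U m
  -- concavity of the drift
  μ_twice : DifferentiableOn ℝ (deriv μ) (Ici 0)
  μ_second : ∀ x, 0 ≤ x → derivWithin (deriv μ) (Ici 0) x ≤ 0
  -- monotone hazard rate property (at `0` the ratio is `+∞`)
  hazard : AntitoneOn (fun m => f m / ProbabilityTheory.cdf Q m) (Ioc 0 ybar)

namespace Model

variable (M : Model)

/-- The cumulative distribution function of the tipping point. -/
def F (m : ℝ) : ℝ := ProbabilityTheory.cdf M.Q m

/-- The point at which `μ - r U` changes sign from positive to negative. -/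
def xbar : ℝ := sSup {x : ℝ | 0 ≤ x ∧ 0 < M.μ x - M.r * M.U x}

/-- `u` is a classical solution of `ℒ u = r u` on the state space, where
`ℒ u = μ u' + (σ² / 2) u''`. -/
def SolvesHomogeneous (u : ℝ → ℝ) : Prop :=
  ContDiffOn ℝ 2 u (stateSpace M.α) ∧
  ∀ x ∈ stateSpace M.α,
    M.μ x * deriv u x + M.σ x ^ 2 / 2 * deriv (deriv u) x = M.r * u x

/-- `ψ` and `φ` are the increasing and the decreasing fundamental solution of `ℒ u = r u`:
positive solutions, the first increasing and the second decreasing. -/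
structure IsFundamentalPair (ψ φ : ℝ → ℝ) : Prop where
  solves_ψ : M.SolvesHomogeneous ψ
  solves_φ : M.SolvesHomogeneous φ
  pos_ψ : ∀ x ∈ stateSpace M.α, 0 < ψ x
  pos_φ : ∀ x ∈ stateSpace M.α, 0 < φ x
  increasing_ψ : StrictMonoOn ψ (stateSpace M.α)
  decreasing_φ : StrictAntiOn φ (stateSpace M.α)

/-- `D(x,m) = ψ'(x) φ(m) - φ'(x) ψ(m)`. -/
def D (ψ φ : ℝ → ℝ) (x m : ℝ) : ℝ := deriv ψ x * φ m - deriv φ x * ψ m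

/-- `N(x,m) = φ(x) ψ(m) - ψ(x) φ(m) + D(x,m) μ(x)/r - D(x,x) U(m)`. -/
def N (ψ φ : ℝ → ℝ) (x m : ℝ) : ℝ :=
  φ x * ψ m - ψ x * φ m + D ψ φ x m * (M.μ x / M.r) - D ψ φ x x * M.U m

/-- The hazard rate `H = f / F`. -/
def H (m : ℝ) : ℝ := M.f m / M.F m

/-- `G(x) = 1 - μ'(x)/r`. -/
def G (x : ℝ) : ℝ := 1 - deriv M.μ x / M.r

/-- The vector field `E(x,m) = (H(m)/G(x)) (N(x,m)/D(x,m))`. -/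
def E (ψ φ : ℝ → ℝ) (x m : ℝ) : ℝ :=
  M.H m / M.G x * (M.N ψ φ x m / D ψ φ x m)

/-- The auxiliary threshold: the solution `x ∈ [0, ∞)` of `N(x,m) = 0`. -/
def eta (ψ φ : ℝ → ℝ) (m : ℝ) : ℝ := sInf {x : ℝ | 0 ≤ x ∧ M.N ψ φ x m = 0}

/-- `b : [0, xbar] → [0, xbar]` solves the singular Cauchy problem.
Only the values of `b` on `[0, xbar]` matter. -/
structure IsCauchySolution (ψ φ : ℝ → ℝ) (b : ℝ → ℝ) : Prop where
  mapsTo : MapsTo b (Icc 0 M.xbar) (Icc 0 M.xbar)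
  continuousOn : ContinuousOn b (Icc 0 M.xbar)
  contDiffOn : ContDiffOn ℝ 1 b (Ioo 0 (min M.xbar M.ybar))
  initial : b 0 = M.eta ψ φ 0
  ode : ∀ m ∈ Ioo 0 (min M.xbar M.ybar), HasDerivAt b (M.E ψ φ (b m) m) m
  const : ∀ m ∈ Icc 0 M.xbar, min M.xbar M.ybar < m → b m = b (min M.xbar M.ybar)

end Model

end Tipping

end

/-!
The proof rests on one computation. Put `W(x) = D(x,x)`, the Wronskian of `ψ` and `φ`. Then
`∂ₓ(N(x,m) / W(x)) = -G(x) D(x,m) / W(x)` (`hasDerivAt_N_div`), so `N(·,m) / W` decreases, and for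
`m ≤ xbar` it falls from a nonnegative value at `x = m`, where `N(m,m) = W(m) (μ(m)/r - U(m))`, to a
unique zero `eta m ≥ m`. The sign of `E(·,m)` changes there from positive to negative.

In the variable `m`, `N(x,·) = q - W(x) U`, where `q` is the `r`-harmonic function with slope `W(x)`
and zero curvature at `x`. To the left of `x` the slope of `q` exceeds `W(x)`, because `μ' < r`
(`SolvesHomogeneous.deriv_lt_of_lt`). Above `ustar` the slope of `U` is `1`, so `N(x,·)` increases;
below `ustar`, `ℒ U > r U` makes `N(x,·)` a strict supersolution, which has no nonpositive interior
minimum. Hence `N(eta m₁, ·)` is positive between `m₁` and `eta m₁` (`N_pos_of_eq_zero`), and `eta`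
is strictly increasing, with `eta xbar = xbar`.

Since `eta` increases and `E ≤ 0` above it, every solution of the Cauchy problem stays below `eta`
and is therefore nondecreasing. The equation is singular at `m = 0`, where the hazard rate blows up,
but this does no harm. For uniqueness, `E(·,m)` is nonincreasing between `m` and `eta m` (`E_anti`),
so the distance of two solutions cannot grow away from `0`; further on the field is Lipschitz in
`x`. For existence, curves started at height `eta 0` at small positive times are trapped between
`eta 0` and `eta`, a subsequence of them has convergent terminal values, and by backward continuous
dependence it converges to a solution on all of `(0, xbar ∧ ybar]`. The trap forces the initial
value, since `eta` is right continuous at `0`.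

A solution starts above the diagonal and ends below `xbar`: it cannot reach `xbar`, where `E ≤ 0`,
by Grönwall's inequality. So it has a first fixed point in `(0, xbar)`. On the diagonal `E` is
nonincreasing, by the monotone hazard rate and the concavity of `μ`. If its value at the first
fixed point were at least `1`, then it would be at least `1` all the way before it, and Grönwall's
inequality for `b(m) - m` would keep `b` strictly above the diagonal.
-/

namespace Tipping

open Filter Topology

/-! ### Monotonicity lemmas on intervals -/

/-- A function whose derivative is nonpositive wherever it exceeds `c` cannot cross the level `c`
upwards. -/
lemma le_of_deriv_nonpos_above {g : ℝ → ℝ} {a b c : ℝ} (hg : ContinuousOn g (Icc a b))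
    (ha : g a ≤ c) (hd : ∀ t ∈ Ioo a b, c < g t → ∃ d ≤ 0, HasDerivAt g d t) :
    ∀ t ∈ Icc a b, g t ≤ c := by
  intro t ht
  by_contra! hct
  have hsub : Icc a t ⊆ Icc a b := Icc_subset_Icc_right ht.2
  obtain ⟨s, ⟨hs, hsc⟩, hmax⟩ : ∃ s, IsGreatest (Icc a t ∩ g ⁻¹' Iic c) s := by
    refine IsCompact.exists_isGreatest ?_ ⟨a, ⟨le_rfl, ht.1⟩, ha⟩
    exact isCompact_Icc.of_isClosed_subset
      ((hg.mono hsub).preimage_isClosed_of_isClosed isClosed_Icc isClosed_Iic) inter_subset_left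
  have habove : ∀ u ∈ Ioo s t, c < g u := by
    intro u hu
    by_contra! hle
    exact absurd (hmax ⟨⟨hs.1.trans hu.1.le, hu.2.le⟩, hle⟩) (not_le.2 hu.1)
  have hderiv : ∀ u ∈ Ioo s t, ∃ d ≤ 0, HasDerivAt g d u := fun u hu =>
    hd u ⟨hs.1.trans_lt hu.1, hu.2.trans_le ht.2⟩ (habove u hu)
  have hanti : AntitoneOn g (Icc s t) := by
    apply antitoneOn_of_deriv_nonpos (convex_Icc s t)
      (hg.mono ((Icc_subset_Icc_left hs.1).trans hsub))
    · rw [interior_Icc]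
      intro u hu
      obtain ⟨d, -, h⟩ := hderiv u hu
      exact h.differentiableAt.differentiableWithinAt
    · rw [interior_Icc]
      intro u hu
      obtain ⟨d, h0, h⟩ := hderiv u hu
      rwa [h.deriv]
  have := hanti ⟨le_rfl, hs.2⟩ ⟨hs.2, le_rfl⟩ hs.2
  exact absurd (this.trans hsc) (not_le.2 hct)

/-- Monotonicity from a pointwise derivative in the interior of an interval. -/
lemma monotoneOn_Icc_of_hasDerivAt {g g' : ℝ → ℝ} {a b : ℝ} (hg : ContinuousOn g (Icc a b))
    (hd : ∀ t ∈ Ioo a b, HasDerivAt g (g' t) t) (h0 : ∀ t ∈ Ioo a b, 0 ≤ g' t) :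
    MonotoneOn g (Icc a b) := by
  apply monotoneOn_of_deriv_nonneg (convex_Icc a b) hg
  · rw [interior_Icc]
    exact fun u hu => (hd u hu).differentiableAt.differentiableWithinAt
  · rw [interior_Icc]
    intro u hu
    rw [(hd u hu).deriv]
    exact h0 u hu

/-- Grönwall's inequality for a differential inequality `g' ≥ -K g`, with `K` of any sign. -/
lemma mul_exp_le_of_deriv_ge {g g' : ℝ → ℝ} {a b K : ℝ} (hab : a ≤ b)
    (hg : ContinuousOn g (Icc a b)) (hd : ∀ t ∈ Ioo a b, HasDerivAt g (g' t) t)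
    (h0 : ∀ t ∈ Ioo a b, -K * g t ≤ g' t) :
    g a * Real.exp (K * a) ≤ g b * Real.exp (K * b) := by
  have hmono : MonotoneOn (fun t => g t * Real.exp (K * t)) (Icc a b) := by
    apply monotoneOn_Icc_of_hasDerivAt
      (g' := fun t => g' t * Real.exp (K * t) + g t * (Real.exp (K * t) * (K * 1)))
    · exact hg.mul (by fun_prop)
    · intro t ht
      exact (hd t ht).mul (((hasDerivAt_id t).const_mul K).exp)
    · intro t ht
      have := h0 t ht
      have he := Real.exp_pos (K * t)
      have : 0 ≤ (g' t + K * g t) * Real.exp (K * t) := mul_nonneg (by linarith) he.le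
      nlinarith
  exact hmono ⟨le_rfl, hab⟩ ⟨hab, le_rfl⟩ hab

/-- Continuous dependence, forwards and backwards in time, for two curves whose velocities differ
by at most `K` times their distance. -/
lemma sq_sub_le_of_deriv_sub_le {u v u' v' : ℝ → ℝ} {a b K : ℝ} (hab : a ≤ b)
    (hu : ContinuousOn u (Icc a b)) (hv : ContinuousOn v (Icc a b))
    (hdu : ∀ t ∈ Ioo a b, HasDerivAt u (u' t) t) (hdv : ∀ t ∈ Ioo a b, HasDerivAt v (v' t) t)
    (hK : ∀ t ∈ Ioo a b, |u' t - v' t| ≤ K * |u t - v t|) :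
    (u a - v a) ^ 2 ≤ (u b - v b) ^ 2 * Real.exp (2 * K * (b - a)) ∧
    (u b - v b) ^ 2 ≤ (u a - v a) ^ 2 * Real.exp (2 * K * (b - a)) := by
  have hc : ContinuousOn (fun t => (u t - v t) ^ 2) (Icc a b) := (hu.sub hv).pow 2
  have hd : ∀ t ∈ Ioo a b, HasDerivAt (fun t => (u t - v t) ^ 2)
      (2 * (u t - v t) * (u' t - v' t)) t := by
    intro t ht
    have h := ((hdu t ht).sub (hdv t ht)).pow 2
    norm_num at h
    exact h
  have hb : ∀ t ∈ Ioo a b, |2 * (u t - v t) * (u' t - v' t)| ≤ 2 * K * (u t - v t) ^ 2 := by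
    intro t ht
    have h1 := mul_le_mul_of_nonneg_left (hK t ht) (abs_nonneg (u t - v t))
    rw [abs_mul, abs_mul, abs_two, ← sq_abs (u t - v t)]
    nlinarith
  have key : ∀ p q : ℝ, p * Real.exp (2 * K * a) ≤ q * Real.exp (2 * K * b) →
      p ≤ q * Real.exp (2 * K * (b - a)) := by
    intro p q h
    rw [mul_sub, Real.exp_sub, ← mul_div_assoc]
    exact (le_div_iff₀ (Real.exp_pos _)).2 h
  constructor
  · apply key
    exact mul_exp_le_of_deriv_ge hab hc hd fun t ht => by
      have := (abs_le.1 (hb t ht)).1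
      linarith
  · have := mul_exp_le_of_deriv_ge (K := -(2 * K)) (g := fun t => -(u t - v t) ^ 2) hab hc.neg
      (fun t ht => (hd t ht).neg) fun t ht => by
        have := (abs_le.1 (hb t ht)).2
        simp only [neg_neg]
        linarith
    have h2 : (u b - v b) ^ 2 * Real.exp (-(2 * K) * b) ≤
        (u a - v a) ^ 2 * Real.exp (-(2 * K) * a) := by linarith
    rw [neg_mul, neg_mul, Real.exp_neg, Real.exp_neg, ← div_eq_mul_inv, ← div_eq_mul_inv,
      div_le_div_iff₀ (Real.exp_pos _) (Real.exp_pos _)] at h2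
    exact key _ _ h2

/-- At an interior local minimum the second derivative cannot be negative. -/
lemma not_isLocalMin_of_deriv_neg {k k' : ℝ → ℝ} {z d : ℝ}
    (hk : ∀ᶠ t in 𝓝 z, HasDerivAt k (k' t) t) (hd : HasDerivAt k' d z) (hneg : d < 0) :
    ¬ IsLocalMin k z := by
  intro hmin
  have hderiv : deriv k =ᶠ[𝓝 z] k' := hk.mono fun t ht => ht.deriv
  have h0 : deriv k z = 0 := hmin.deriv_eq_zero
  have h2 : deriv (deriv k) z = d := by rw [hderiv.deriv_eq, hd.deriv]
  have hmax := isLocalMax_of_deriv_deriv_neg (h2 ▸ hneg) h0 hk.self_of_nhds.continuousAt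
  have hconst : k =ᶠ[𝓝 z] fun _ => k z := by
    filter_upwards [hmin, hmax] with t h1 h2 using le_antisymm h2 h1
  have hzero : deriv k =ᶠ[𝓝 z] fun _ => 0 := by
    simpa using hconst.deriv
  rw [hzero.deriv_eq, deriv_const] at h2
  exact hneg.ne h2.symm

/-! ### The diffusion on the half-line `[0, ∞)` -/

lemma isOpen_stateSpace (α : EReal) : IsOpen (stateSpace α) :=
  isOpen_Ioi.preimage continuous_coe_real_ereal

namespace Model

variable {M : Model}

lemma mem_stateSpace {x : ℝ} (hx : 0 ≤ x) : x ∈ stateSpace M.α :=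
  lt_of_lt_of_le M.α_neg (by exact_mod_cast hx)

lemma stateSpace_mem_nhds {x : ℝ} (hx : 0 ≤ x) : stateSpace M.α ∈ 𝓝 x :=
  (isOpen_stateSpace M.α).mem_nhds (mem_stateSpace hx)

lemma hasDerivAt_μ {x : ℝ} (hx : 0 ≤ x) : HasDerivAt M.μ (deriv M.μ x) x :=
  ((M.μ_contDiff.differentiableOn one_ne_zero).differentiableAt
    (stateSpace_mem_nhds hx)).hasDerivAt

lemma antitoneOn_deriv_μ : AntitoneOn (deriv M.μ) (Ici 0) := by
  apply antitoneOn_of_deriv_nonpos (convex_Ici 0) M.μ_twice.continuousOn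
    (M.μ_twice.mono interior_subset)
  intro x hx
  rw [interior_Ici] at hx
  rw [← derivWithin_of_mem_nhds (Ici_mem_nhds hx)]
  exact M.μ_second x (le_of_lt hx)

lemma deriv_μ_lt_r {x : ℝ} (hx : 0 ≤ x) : deriv M.μ x < M.r := by
  obtain ⟨c, hc, h⟩ := M.deriv_μ_lt
  exact (h x hx).trans_lt hc

lemma G_pos {x : ℝ} (hx : 0 ≤ x) : 0 < M.G x := by
  have := (div_lt_one M.r_pos).2 (deriv_μ_lt_r (M := M) hx)
  unfold G
  linarith

lemma monotoneOn_G : MonotoneOn M.G (Ici 0) := by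
  intro x hx y hy hxy
  have := div_le_div_of_nonneg_right (antitoneOn_deriv_μ (M := M) hx hy hxy) M.r_pos.le
  unfold G
  linarith

lemma continuousOn_G : ContinuousOn M.G (Ici 0) :=
  continuousOn_const.sub (M.μ_twice.continuousOn.div_const _)

/-! ### The fundamental solutions -/

lemma SolvesHomogeneous.hasDerivAt {u : ℝ → ℝ} (hu : M.SolvesHomogeneous u) {x : ℝ}
    (hx : 0 ≤ x) : HasDerivAt u (deriv u x) x :=
  ((hu.1.differentiableOn two_ne_zero).differentiableAt (stateSpace_mem_nhds hx)).hasDerivAt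

lemma SolvesHomogeneous.hasDerivAt_deriv {u : ℝ → ℝ} (hu : M.SolvesHomogeneous u) {x : ℝ}
    (hx : 0 ≤ x) :
    HasDerivAt (deriv u) (2 / M.σ x ^ 2 * (M.r * u x - M.μ x * deriv u x)) x := by
  have h2 : ContDiffOn ℝ (1 + 1) u (stateSpace M.α) := by
    have := hu.1
    rwa [← one_add_one_eq_two] at this
  have h1 := ((contDiffOn_succ_iff_deriv_of_isOpen (isOpen_stateSpace M.α)).1 h2).2.2
  have h := ((h1.differentiableOn one_ne_zero).differentiableAt
    (stateSpace_mem_nhds hx)).hasDerivAt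
  have hode := hu.2 x (mem_stateSpace hx)
  have hσ := M.σ_pos x (mem_stateSpace hx)
  refine h.congr_deriv ?_
  field_simp
  linarith

variable {ψ φ : ℝ → ℝ}

/-- A critical point of `ψ` would be a strict local minimum, by the differential equation. -/
lemma deriv_ψ_pos (h : M.IsFundamentalPair ψ φ) {x : ℝ} (hx : 0 ≤ x) : 0 < deriv ψ x := by
  have hopen := isOpen_stateSpace M.α
  have hnonneg : ∀ᶠ y in 𝓝 x, 0 ≤ deriv ψ y := by
    filter_upwards [stateSpace_mem_nhds (M := M) hx] with y hy
    rw [← derivWithin_of_isOpen hopen hy]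
    exact h.increasing_ψ.monotoneOn.derivWithin_nonneg
  refine hnonneg.self_of_nhds.lt_of_ne' fun h0 => ?_
  have hmin : IsLocalMin (deriv ψ) x := by
    filter_upwards [hnonneg] with y hy
    rwa [h0]
  have h2 := hmin.hasDerivAt_eq_zero (h.solves_ψ.hasDerivAt_deriv hx)
  have hσ := M.σ_pos x (mem_stateSpace hx)
  have hψ := h.pos_ψ x (mem_stateSpace hx)
  have hr := M.r_pos
  rw [h0, mul_zero, sub_zero] at h2
  have : 0 < 2 / M.σ x ^ 2 * (M.r * ψ x) := by positivity
  exact this.ne' h2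

lemma deriv_φ_neg (h : M.IsFundamentalPair ψ φ) {x : ℝ} (hx : 0 ≤ x) : deriv φ x < 0 := by
  have hopen := isOpen_stateSpace M.α
  have hnonpos : ∀ᶠ y in 𝓝 x, deriv φ y ≤ 0 := by
    filter_upwards [stateSpace_mem_nhds (M := M) hx] with y hy
    rw [← derivWithin_of_isOpen hopen hy]
    exact h.decreasing_φ.antitoneOn.derivWithin_nonpos
  refine hnonpos.self_of_nhds.lt_of_ne fun h0 => ?_
  have hmax : IsLocalMax (deriv φ) x := by
    filter_upwards [hnonpos] with y hy
    rwa [h0]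
  have h2 := hmax.hasDerivAt_eq_zero (h.solves_φ.hasDerivAt_deriv hx)
  have hσ := M.σ_pos x (mem_stateSpace hx)
  have hφ := h.pos_φ x (mem_stateSpace hx)
  have hr := M.r_pos
  rw [h0, mul_zero, sub_zero] at h2
  have : 0 < 2 / M.σ x ^ 2 * (M.r * φ x) := by positivity
  exact this.ne' h2

lemma D_pos (h : M.IsFundamentalPair ψ φ) {x m : ℝ} (hx : 0 ≤ x) (hm : 0 ≤ m) :
    0 < D ψ φ x m := by
  have h1 := mul_pos (deriv_ψ_pos h hx) (h.pos_φ m (mem_stateSpace hm))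
  have h2 := mul_neg_of_neg_of_pos (deriv_φ_neg h hx) (h.pos_ψ m (mem_stateSpace hm))
  unfold D
  linarith

/-- The Wronskian `D(x,x)` satisfies Abel's identity. -/
lemma hasDerivAt_wronskian (h : M.IsFundamentalPair ψ φ) {x : ℝ} (hx : 0 ≤ x) :
    HasDerivAt (fun y => D ψ φ y y) (-(2 * M.μ x / M.σ x ^ 2) * D ψ φ x x) x := by
  have := ((h.solves_ψ.hasDerivAt_deriv hx).mul (h.solves_φ.hasDerivAt hx)).sub
    ((h.solves_φ.hasDerivAt_deriv hx).mul (h.solves_ψ.hasDerivAt hx))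
  have hσ := M.σ_pos x (mem_stateSpace hx)
  refine this.congr_deriv ?_
  unfold D
  field_simp
  ring

lemma hasDerivAt_D (h : M.IsFundamentalPair ψ φ) {x : ℝ} (hx : 0 ≤ x) (m : ℝ) :
    HasDerivAt (fun y => D ψ φ y m)
      (-(2 / M.σ x ^ 2) * (M.r * (φ x * ψ m - ψ x * φ m) + M.μ x * D ψ φ x m)) x := by
  have := ((h.solves_ψ.hasDerivAt_deriv hx).mul_const (φ m)).sub
    ((h.solves_φ.hasDerivAt_deriv hx).mul_const (ψ m))
  refine this.congr_deriv ?_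
  unfold D
  ring

/-- The ratio `D(x,m) / D(x,x)` is the scale derivative of an `r`-harmonic function
that vanishes at `m`. -/
lemma hasDerivAt_D_div (h : M.IsFundamentalPair ψ φ) {x : ℝ} (hx : 0 ≤ x) (m : ℝ) :
    HasDerivAt (fun y => D ψ φ y m / D ψ φ y y)
      (2 / M.σ x ^ 2 * M.r * (ψ x * φ m - φ x * ψ m) / D ψ φ x x) x := by
  have hW := D_pos h hx hx
  have hσ := M.σ_pos x (mem_stateSpace hx)
  refine ((hasDerivAt_D h hx m).div (hasDerivAt_wronskian h hx) hW.ne').congr_deriv ?_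
  field_simp
  ring

/-- The key identity `∂ₓ(N / D(x,x)) = -G D / D(x,x)`. -/
lemma hasDerivAt_N_div (h : M.IsFundamentalPair ψ φ) {x : ℝ} (hx : 0 ≤ x) (m : ℝ) :
    HasDerivAt (fun y => M.N ψ φ y m / D ψ φ y y)
      (-(M.G x * (D ψ φ x m / D ψ φ x x))) x := by
  have hW := D_pos h hx hx
  have hσ := M.σ_pos x (mem_stateSpace hx)
  have hr := M.r_pos
  have hN := (((((h.solves_φ.hasDerivAt hx).mul_const (ψ m)).sub
    ((h.solves_ψ.hasDerivAt hx).mul_const (φ m)))).add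
    ((hasDerivAt_D h hx m).mul ((hasDerivAt_μ (M := M) hx).div_const M.r))).sub
    ((hasDerivAt_wronskian h hx).mul_const (M.U m))
  refine (hN.div (hasDerivAt_wronskian h hx) hW.ne').congr_deriv ?_
  simp only [Pi.sub_apply, Pi.add_apply, Pi.mul_apply]
  have hD : D ψ φ x m = deriv ψ x * φ m - deriv φ x * ψ m := rfl
  generalize D ψ φ x x = W at *
  unfold G
  field_simp
  rw [hD]
  ring

lemma antitoneOn_of_hasDerivAt_Ici {g g' : ℝ → ℝ} {a : ℝ}
    (hd : ∀ t, a ≤ t → HasDerivAt g (g' t) t) (h0 : ∀ t, a ≤ t → g' t ≤ 0) :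
    AntitoneOn g (Ici a) := by
  apply antitoneOn_of_deriv_nonpos (convex_Ici a)
    (fun t ht => (hd t ht).continuousAt.continuousWithinAt)
  · exact fun u hu => (hd u (interior_subset hu)).differentiableAt.differentiableWithinAt
  · intro u hu
    rw [(hd u (interior_subset hu)).deriv]
    exact h0 u (interior_subset hu)

lemma strictAntiOn_N_div (h : M.IsFundamentalPair ψ φ) {m : ℝ} (hm : 0 ≤ m) :
    StrictAntiOn (fun x => M.N ψ φ x m / D ψ φ x x) (Ici 0) := by
  apply strictAntiOn_of_deriv_neg (convex_Ici 0)
    (fun t ht => (hasDerivAt_N_div h ht m).continuousAt.continuousWithinAt)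
  intro x hx
  have hx : 0 ≤ x := interior_subset (s := Ici (0 : ℝ)) hx
  rw [(hasDerivAt_N_div h hx m).deriv]
  have := mul_pos (G_pos (M := M) hx) (div_pos (D_pos h hx hm) (D_pos h hx hx))
  linarith

lemma monotoneOn_D_div (h : M.IsFundamentalPair ψ φ) {m : ℝ} (hm : 0 ≤ m) :
    MonotoneOn (fun x => D ψ φ x m / D ψ φ x x) (Ici m) := by
  have := antitoneOn_of_hasDerivAt_Ici (g := fun x => -(D ψ φ x m / D ψ φ x x)) (a := m)
    (fun t ht => (hasDerivAt_D_div h (hm.trans ht) m).neg) ?_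
  · intro x hx y hy hxy
    exact neg_le_neg_iff.1 (this hx hy hxy)
  · intro t ht
    have ht0 := hm.trans ht
    have hW := D_pos h ht0 ht0
    have h1 := h.increasing_ψ.monotoneOn (mem_stateSpace hm) (mem_stateSpace ht0) ht
    have h2 := h.decreasing_φ.antitoneOn (mem_stateSpace hm) (mem_stateSpace ht0) ht
    have h3 := h.pos_ψ m (mem_stateSpace hm)
    have h4 := h.pos_φ m (mem_stateSpace hm)
    have h5 : 0 ≤ ψ t * φ m - φ t * ψ m := by nlinarith
    have hr := M.r_pos
    have : 0 ≤ 2 / M.σ t ^ 2 * M.r * (ψ t * φ m - φ t * ψ m) / D ψ φ t t := by positivity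
    linarith

lemma N_self (m : ℝ) : M.N ψ φ m m = D ψ φ m m * (M.μ m / M.r - M.U m) := by
  unfold N
  ring

/-! ### The continuation value and the point `xbar` -/

lemma one_le_derivWithin_U {m : ℝ} (hm : 0 ≤ m) : 1 ≤ derivWithin M.U (Ici 0) m := by
  rcases le_total m M.ustar with h | h
  · exact M.one_le_deriv_U m hm h
  · exact (M.deriv_U_eq_one m h).ge

lemma hasDerivAt_U {m : ℝ} (hm : 0 < m) : HasDerivAt M.U (derivWithin M.U (Ici 0) m) m :=
  ((M.U_contDiff.differentiableOn two_ne_zero m hm.le).hasDerivWithinAt).hasDerivAt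
    (Ici_mem_nhds hm)

lemma contDiffOn_deriv_U : ContDiffOn ℝ 1 (derivWithin M.U (Ici 0)) (Ici 0) :=
  M.U_contDiff.derivWithin (uniqueDiffOn_Ici 0) (by norm_num)

lemma hasDerivAt_deriv_U {m : ℝ} (hm : 0 < m) :
    HasDerivAt (derivWithin M.U (Ici 0)) (iteratedDerivWithin 2 M.U (Ici 0) m) m := by
  have h := ((contDiffOn_deriv_U.differentiableOn one_ne_zero m hm.le).hasDerivWithinAt).hasDerivAt
    (Ici_mem_nhds hm) (F := ℝ) (f := derivWithin M.U (Ici 0))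
  rw [iteratedDerivWithin_succ, iteratedDerivWithin_one]
  exact h

/-- The function `μ - r U`, whose sign change defines `xbar`. -/
def netDrift (M : Model) (x : ℝ) : ℝ := M.μ x - M.r * M.U x

lemma continuousOn_U : ContinuousOn M.U (Ici 0) := M.U_contDiff.continuousOn

lemma continuousOn_μ : ContinuousOn M.μ (Ici 0) :=
  M.μ_contDiff.continuousOn.mono fun _ hx => mem_stateSpace hx

lemma continuousOn_netDrift : ContinuousOn M.netDrift (Ici 0) :=
  continuousOn_μ.sub (continuousOn_const.mul continuousOn_U)

/-- `μ - r U` decreases at a uniform positive rate, since `μ' ≤ c < r` and `U' ≥ 1`. -/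
lemma netDrift_add_le : ∃ κ > 0, ∀ x y, 0 ≤ x → x ≤ y →
    M.netDrift y + κ * (y - x) ≤ M.netDrift x := by
  obtain ⟨c, hc, hcμ⟩ := M.deriv_μ_lt
  refine ⟨M.r - c, by linarith, fun x y hx hxy => ?_⟩
  have := monotoneOn_Icc_of_hasDerivAt (g := fun t => -M.netDrift t - (M.r - c) * t)
    (g' := fun t => -(deriv M.μ t - M.r * derivWithin M.U (Ici 0) t) - (M.r - c) * 1)
    (a := x) (b := y) ?_ ?_ ?_ ⟨le_rfl, hxy⟩ ⟨hxy, le_rfl⟩ hxy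
  · simp only at this
    linarith
  · exact (continuousOn_netDrift.mono fun t ht => hx.trans ht.1).neg.sub (by fun_prop)
  · intro t ht
    have ht0 : 0 < t := hx.trans_lt ht.1
    exact ((hasDerivAt_μ ht0.le).sub ((hasDerivAt_U ht0).const_mul M.r)).neg.sub
      ((hasDerivAt_id t).const_mul _)
  · intro t ht
    have ht0 : 0 < t := hx.trans_lt ht.1
    have h1 := hcμ t ht0.le
    have h2 := mul_le_mul_of_nonneg_left (one_le_derivWithin_U (M := M) ht0.le) M.r_pos.le
    linarith

lemma strictAntiOn_netDrift : StrictAntiOn M.netDrift (Ici 0) := by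
  obtain ⟨κ, hκ, h⟩ := netDrift_add_le (M := M)
  intro x hx y hy hxy
  have := h x y hx hxy.le
  have := mul_pos hκ (sub_pos.2 hxy)
  linarith

lemma xbar_spec : 0 < M.xbar ∧ M.netDrift M.xbar = 0 := by
  obtain ⟨κ, hκ, h⟩ := netDrift_add_le (M := M)
  have h0 : 0 < M.netDrift 0 := sub_pos.2 M.μ_zero
  set y := M.netDrift 0 / κ with hy
  have hypos : 0 < y := by positivity
  have hy0 : M.netDrift y ≤ 0 := by
    have h1 := h 0 y le_rfl hypos.le
    rw [sub_zero, hy, mul_div_cancel₀ _ hκ.ne'] at h1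
    linarith
  obtain ⟨z, hz, hz0⟩ := intermediate_value_Icc' hypos.le
    (continuousOn_netDrift.mono fun t ht => ht.1) ⟨hy0, h0.le⟩
  have hz1 : 0 < z := hz.1.lt_of_ne fun he => by
    rw [← he] at hz0
    exact h0.ne' hz0
  have hset : {x : ℝ | 0 ≤ x ∧ 0 < M.μ x - M.r * M.U x} = Ico 0 z := by
    ext x
    constructor
    · rintro ⟨hx, hpos⟩
      refine ⟨hx, ?_⟩
      by_contra! hzx
      have := (strictAntiOn_netDrift (M := M)).antitoneOn hz.1 hx hzx
      rw [hz0] at this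
      exact absurd hpos (not_lt.2 this)
    · rintro ⟨hx, hxz⟩
      refine ⟨hx, ?_⟩
      have := strictAntiOn_netDrift (M := M) hx hz.1 hxz
      rwa [hz0] at this
  have : M.xbar = z := by
    unfold xbar
    rw [hset, csSup_Ico hz1]
  rw [this]
  exact ⟨hz1, hz0⟩

lemma xbar_pos : 0 < M.xbar := xbar_spec.1

lemma netDrift_pos {x : ℝ} (hx : 0 ≤ x) (hxb : x < M.xbar) : 0 < M.netDrift x :=
  (xbar_spec (M := M)).2 ▸ strictAntiOn_netDrift hx xbar_pos.le hxb

lemma netDrift_nonneg {x : ℝ} (hx : 0 ≤ x) (hxb : x ≤ M.xbar) : 0 ≤ M.netDrift x :=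
  (xbar_spec (M := M)).2 ▸ strictAntiOn_netDrift.antitoneOn hx xbar_pos.le hxb

/-- At `ustar` the inequality `ℒ U - r U > 0` becomes `μ - r U ≥ 0` in the limit. -/
lemma ustar_le_xbar : M.ustar ≤ M.xbar := by
  rcases M.ustar_nonneg.eq_or_lt with h0 | hpos
  · rw [← h0]
    exact xbar_pos.le
  by_contra! hlt
  have hneg : M.netDrift M.ustar < 0 :=
    (xbar_spec (M := M)).2 ▸ strictAntiOn_netDrift xbar_pos.le hpos.le hlt
  have hU2 : iteratedDerivWithin 2 M.U (Ici 0) M.ustar = 0 := by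
    have h1 := (hasDerivAt_deriv_U (M := M) hpos).hasDerivWithinAt (s := Ici M.ustar)
    have h2 : HasDerivWithinAt (derivWithin M.U (Ici 0)) 0 (Ici M.ustar) M.ustar :=
      (hasDerivWithinAt_const M.ustar (Ici M.ustar) (1 : ℝ)).congr
        (fun m hm => M.deriv_U_eq_one m hm) (M.deriv_U_eq_one _ le_rfl)
    exact (uniqueDiffWithinAt_Ici M.ustar).eq_deriv _ h1 h2
  have hc : ContinuousAt (fun m => M.μ m * derivWithin M.U (Ici 0) m
      + M.σ m ^ 2 / 2 * iteratedDerivWithin 2 M.U (Ici 0) m - M.r * M.U m) M.ustar := by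
    have hσ : ContinuousAt M.σ M.ustar :=
      M.σ_contDiff.continuousOn.continuousAt (stateSpace_mem_nhds hpos.le)
    have h2 : ContinuousAt (iteratedDerivWithin 2 M.U (Ici 0)) M.ustar :=
      (M.U_contDiff.continuousOn_iteratedDerivWithin (le_refl _)
        (uniqueDiffOn_Ici 0)).continuousAt (Ici_mem_nhds hpos)
    exact (((hasDerivAt_μ hpos.le).continuousAt.mul (hasDerivAt_deriv_U hpos).continuousAt).add
      (((hσ.pow 2).div_const 2).mul h2)).sub
      (continuousAt_const.mul (hasDerivAt_U hpos).continuousAt)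
  have hlim := hc.tendsto.mono_left (nhdsWithin_le_nhds (s := Iio M.ustar))
  have hge := ge_of_tendsto hlim (b := 0) (by
    filter_upwards [Ioo_mem_nhdsLT hpos] with m hm
    exact (M.generator_U_pos m hm.1.le hm.2).le)
  rw [hU2, M.deriv_U_eq_one _ le_rfl] at hge
  unfold netDrift at hneg
  linarith

/-! ### Monotonicity of `N` in its second argument along its zero set -/

lemma SolvesHomogeneous.add_smul {u v : ℝ → ℝ} (hu : M.SolvesHomogeneous u)
    (hv : M.SolvesHomogeneous v) (a b : ℝ) :
    M.SolvesHomogeneous (fun m => a * u m + b * v m) := by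
  have hopen := isOpen_stateSpace M.α
  have hdiff : ∀ {w : ℝ → ℝ}, M.SolvesHomogeneous w → ∀ y ∈ stateSpace M.α,
      DifferentiableAt ℝ w y ∧ DifferentiableAt ℝ (deriv w) y := by
    intro w hw y hy
    have h2 : ContDiffOn ℝ (1 + 1) w (stateSpace M.α) := by
      have := hw.1
      rwa [← one_add_one_eq_two] at this
    have h1 := ((contDiffOn_succ_iff_deriv_of_isOpen hopen).1 h2).2.2
    exact ⟨(hw.1.differentiableOn two_ne_zero).differentiableAt (hopen.mem_nhds hy),
      (h1.differentiableOn one_ne_zero).differentiableAt (hopen.mem_nhds hy)⟩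
  have hd : ∀ y ∈ stateSpace M.α,
      deriv (fun m => a * u m + b * v m) y = a * deriv u y + b * deriv v y := fun y hy =>
    (((hdiff hu y hy).1.hasDerivAt.const_mul a).add
      ((hdiff hv y hy).1.hasDerivAt.const_mul b)).deriv
  refine ⟨(contDiffOn_const.mul hu.1).add (contDiffOn_const.mul hv.1), fun x hx => ?_⟩
  have hd2 : deriv (deriv (fun m => a * u m + b * v m)) x
      = a * deriv (deriv u) x + b * deriv (deriv v) x := by
    have : deriv (fun m => a * u m + b * v m) =ᶠ[𝓝 x] fun y => a * deriv u y + b * deriv v y := by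
      filter_upwards [hopen.mem_nhds hx] with y hy using hd y hy
    rw [this.deriv_eq]
    exact (((hdiff hu x hx).2.hasDerivAt.const_mul a).add
      ((hdiff hv x hx).2.hasDerivAt.const_mul b)).deriv
  rw [hd x hx, hd2]
  linear_combination a * hu.2 x hx + b * hv.2 x hx

/-- An `r`-harmonic function with positive slope and zero curvature at `x` (the smooth-fit
conditions) is strictly concave to the left of `x`: its slope there exceeds the slope at `x`. -/
lemma SolvesHomogeneous.deriv_lt_of_lt (h : M.IsFundamentalPair ψ φ) {u : ℝ → ℝ}
    (hu : M.SolvesHomogeneous u) {x : ℝ} (hpos : 0 < deriv u x)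
    (hfit : M.r * u x = M.μ x * deriv u x) {m : ℝ} (hm : 0 ≤ m) (hmx : m < x) :
    deriv u x < deriv u m := by
  have hcont : ∀ s, 0 ≤ s → ContinuousOn (deriv u) (Icc s x) := fun s hs t ht =>
    (hu.hasDerivAt_deriv (hs.trans ht.1)).continuousAt.continuousWithinAt
  -- The curvature, divided by the Wronskian, is increasing as long as the slope is positive.
  have hcurv : ∀ t, 0 ≤ t → HasDerivAt
      (fun y => (M.r * u y - M.μ y * deriv u y) / D ψ φ y y)
      ((M.r - deriv M.μ t) * deriv u t / D ψ φ t t) t := by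
    intro t ht
    have hW := D_pos h ht ht
    have hσ := M.σ_pos t (mem_stateSpace ht)
    refine ((((hu.hasDerivAt ht).const_mul M.r).sub ((hasDerivAt_μ ht).mul
      (hu.hasDerivAt_deriv ht))).div (hasDerivAt_wronskian h ht) hW.ne').congr_deriv ?_
    simp only [Pi.sub_apply, Pi.mul_apply]
    generalize D ψ φ t t = W at *
    field_simp
    ring
  have hstep : ∀ s, 0 ≤ s → s < x → (∀ t ∈ Ioo s x, 0 < deriv u t) → deriv u x < deriv u s := by
    intro s hs hsx hp
    have hmono : StrictMonoOn (fun y => (M.r * u y - M.μ y * deriv u y) / D ψ φ y y)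
        (Icc s x) := by
      apply strictMonoOn_of_deriv_pos (convex_Icc s x)
      · exact fun t ht => (hcurv t (hs.trans ht.1)).continuousAt.continuousWithinAt
      · rw [interior_Icc]
        intro t ht
        have ht0 := hs.trans ht.1.le
        rw [(hcurv t ht0).deriv]
        exact div_pos (mul_pos (sub_pos.2 (deriv_μ_lt_r ht0)) (hp t ht)) (D_pos h ht0 ht0)
    have hanti : StrictAntiOn (deriv u) (Icc s x) := by
      apply strictAntiOn_of_deriv_neg (convex_Icc s x) (hcont s hs)
      rw [interior_Icc]
      intro t ht
      have ht0 := hs.trans ht.1.le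
      rw [(hu.hasDerivAt_deriv ht0).deriv]
      have h1 := hmono ⟨ht.1.le, ht.2.le⟩ ⟨hsx.le, le_rfl⟩ ht.2
      simp only at h1
      rw [hfit, sub_self, zero_div, div_lt_iff₀ (D_pos h ht0 ht0), zero_mul] at h1
      have hσ := M.σ_pos t (mem_stateSpace ht0)
      exact mul_neg_of_pos_of_neg (by positivity) h1
    exact hanti ⟨le_rfl, hsx.le⟩ ⟨hsx.le, le_rfl⟩ hsx
  apply hstep m hm hmx
  by_contra! hex
  obtain ⟨t₀, ht₀, hle⟩ := hex
  obtain ⟨s, ⟨hs, hs0⟩, hmax⟩ : ∃ s, IsGreatest (Icc m x ∩ deriv u ⁻¹' Iic 0) s := by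
    refine IsCompact.exists_isGreatest ?_ ⟨t₀, ⟨ht₀.1.le, ht₀.2.le⟩, hle⟩
    exact isCompact_Icc.of_isClosed_subset
      ((hcont m hm).preimage_isClosed_of_isClosed isClosed_Icc isClosed_Iic) inter_subset_left
  have hsx : s < x := hs.2.lt_of_ne fun he => by
    rw [he] at hs0
    exact absurd hpos (not_lt.2 hs0)
  have := hstep s (hm.trans hs.1) hsx fun t ht => by
    by_contra! hle
    exact absurd (hmax ⟨⟨hs.1.trans ht.1.le, ht.2.le⟩, hle⟩) (not_le.2 ht.1)
  exact absurd (hpos.trans this) (not_lt.2 hs0)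

/-- For fixed `x`, the `r`-harmonic part `m ↦ N(x,m) + D(x,x) U(m)` of `N`. -/
noncomputable def harmonicPart (M : Model) (ψ φ : ℝ → ℝ) (x m : ℝ) : ℝ :=
  (φ x - deriv φ x * (M.μ x / M.r)) * ψ m + (deriv ψ x * (M.μ x / M.r) - ψ x) * φ m

lemma N_eq (x m : ℝ) : M.N ψ φ x m = M.harmonicPart ψ φ x m - D ψ φ x x * M.U m := by
  unfold N harmonicPart
  rw [show D ψ φ x m = deriv ψ x * φ m - deriv φ x * ψ m from rfl]
  ring

lemma solves_harmonicPart (h : M.IsFundamentalPair ψ φ) (x : ℝ) :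
    M.SolvesHomogeneous (M.harmonicPart ψ φ x) :=
  h.solves_ψ.add_smul h.solves_φ _ _

lemma deriv_harmonicPart_self (h : M.IsFundamentalPair ψ φ) {x : ℝ} (hx : 0 ≤ x) :
    deriv (M.harmonicPart ψ φ x) x = D ψ φ x x := by
  have := (((h.solves_ψ.hasDerivAt hx).const_mul (φ x - deriv φ x * (M.μ x / M.r))).add
    ((h.solves_φ.hasDerivAt hx).const_mul (deriv ψ x * (M.μ x / M.r) - ψ x))).deriv
  refine this.trans ?_
  unfold D
  ring

lemma wronskian_lt_deriv_harmonicPart (h : M.IsFundamentalPair ψ φ) {x m : ℝ} (hm : 0 ≤ m)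
    (hmx : m < x) : D ψ φ x x < deriv (M.harmonicPart ψ φ x) m := by
  have hx : 0 ≤ x := hm.trans hmx.le
  rw [← deriv_harmonicPart_self h hx]
  apply (solves_harmonicPart h x).deriv_lt_of_lt h _ _ hm hmx
  · rw [deriv_harmonicPart_self h hx]
    exact D_pos h hx hx
  · rw [deriv_harmonicPart_self h hx]
    have hr := M.r_pos
    unfold harmonicPart D
    field_simp
    ring

lemma hasDerivAt_N (h : M.IsFundamentalPair ψ φ) (x : ℝ) {m : ℝ} (hm : 0 < m) :
    HasDerivAt (M.N ψ φ x)
      (deriv (M.harmonicPart ψ φ x) m - D ψ φ x x * derivWithin M.U (Ici 0) m) m := by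
  have : M.N ψ φ x = fun m => M.harmonicPart ψ φ x m - D ψ φ x x * M.U m := funext (N_eq x)
  rw [this]
  exact ((solves_harmonicPart h x).hasDerivAt hm.le).sub ((hasDerivAt_U hm).const_mul _)

lemma continuousOn_N_right (h : M.IsFundamentalPair ψ φ) (x : ℝ) :
    ContinuousOn (M.N ψ φ x) (Ici 0) := by
  have : M.N ψ φ x = fun m => M.harmonicPart ψ φ x m - D ψ φ x x * M.U m := funext (N_eq x)
  rw [this]
  have hc : ContinuousOn (M.harmonicPart ψ φ x) (Ici 0) := fun m hm =>
    ((solves_harmonicPart h x).hasDerivAt hm).continuousAt.continuousWithinAt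
  exact hc.sub (continuousOn_const.mul continuousOn_U)

/-- Below `ustar`, `N(x,·)` is a strict supersolution of `ℒ u = r u`, so it has no interior
minimum at a nonpositive level. -/
lemma not_isLocalMin_N (h : M.IsFundamentalPair ψ φ) {x m : ℝ} (hx : 0 ≤ x) (hm : 0 < m)
    (hmu : m < M.ustar) (hN : M.N ψ φ x m ≤ 0) : ¬ IsLocalMin (M.N ψ φ x) m := by
  intro hmin
  have hσ := M.σ_pos m (mem_stateSpace hm.le)
  have hW := D_pos h hx hx
  have hcrit := hmin.hasDerivAt_eq_zero (hasDerivAt_N h x hm)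
  refine not_isLocalMin_of_deriv_neg
    (k' := fun m => deriv (M.harmonicPart ψ φ x) m - D ψ φ x x * derivWithin M.U (Ici 0) m) ?_
    (((solves_harmonicPart h x).hasDerivAt_deriv hm.le).sub
      ((hasDerivAt_deriv_U hm).const_mul (D ψ φ x x))) ?_ hmin
  · filter_upwards [Ioi_mem_nhds hm] with t ht using hasDerivAt_N h x ht
  · have hgen := mul_pos hW (M.generator_U_pos m hm.le hmu)
    have hr := mul_nonpos_of_nonneg_of_nonpos M.r_pos.le hN
    rw [N_eq] at hr
    rw [show deriv (M.harmonicPart ψ φ x) m = D ψ φ x x * derivWithin M.U (Ici 0) m by linarith]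
    have h0 : M.σ m ^ 2 / 2 * (2 / M.σ m ^ 2 * (M.r * M.harmonicPart ψ φ x m -
        M.μ m * (D ψ φ x x * derivWithin M.U (Ici 0) m)) -
        D ψ φ x x * iteratedDerivWithin 2 M.U (Ici 0) m) < 0 := by
      have : M.σ m ^ 2 / 2 * (2 / M.σ m ^ 2 * (M.r * M.harmonicPart ψ φ x m -
        M.μ m * (D ψ φ x x * derivWithin M.U (Ici 0) m)) -
        D ψ φ x x * iteratedDerivWithin 2 M.U (Ici 0) m) = (M.r * M.harmonicPart ψ φ x m -
        M.μ m * (D ψ φ x x * derivWithin M.U (Ici 0) m)) -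
        M.σ m ^ 2 / 2 * (D ψ φ x x * iteratedDerivWithin 2 M.U (Ici 0) m) := by
        field_simp
      rw [this]
      linarith
    exact neg_of_mul_neg_right h0 (by positivity)

lemma deriv_N_pos (h : M.IsFundamentalPair ψ φ) {x m : ℝ} (hm : 0 ≤ m)
    (hu : M.ustar ≤ m) (hmx : m < x) :
    0 < deriv (M.harmonicPart ψ φ x) m - D ψ φ x x * derivWithin M.U (Ici 0) m := by
  rw [M.deriv_U_eq_one m hu, mul_one, sub_pos]
  exact wronskian_lt_deriv_harmonicPart h hm hmx

/-- Once `N(x,·)` vanishes to the left of `x`, it is positive from there up to `x`. -/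
lemma N_pos_of_eq_zero (h : M.IsFundamentalPair ψ φ) {x m₁ m₂ : ℝ} (hm₁ : 0 ≤ m₁)
    (h₁₂ : m₁ < m₂) (h₂ : m₂ < x) (h0 : M.N ψ φ x m₁ = 0) : 0 < M.N ψ φ x m₂ := by
  have hx : 0 ≤ x := hm₁.trans (h₁₂.le.trans h₂.le)
  have hcont : ContinuousOn (M.N ψ φ x) (Icc m₁ x) :=
    (continuousOn_N_right h x).mono fun t ht => hm₁.trans ht.1
  have hmono : ∀ s, m₁ ≤ s → M.ustar ≤ s → StrictMonoOn (M.N ψ φ x) (Icc s x) := by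
    intro s hs hus
    apply strictMonoOn_of_deriv_pos (convex_Icc s x) (hcont.mono (Icc_subset_Icc_left hs))
    rw [interior_Icc]
    intro t ht
    have ht0 : 0 < t := hm₁.trans_lt (hs.trans_lt ht.1)
    rw [(hasDerivAt_N h x ht0).deriv]
    exact deriv_N_pos h ht0.le (hus.trans ht.1.le) ht.2
  rcases le_or_gt M.ustar m₁ with hu | hu
  · rw [← h0]
    exact hmono m₁ le_rfl hu ⟨le_rfl, h₁₂.le.trans h₂.le⟩ ⟨h₁₂.le, h₂.le⟩ h₁₂
  by_contra! hneg
  -- A negative minimum is not attained at the right end point: if `x ≤ ustar`, then `x ≤ xbar` and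
  -- `N(x,x) ≥ 0`; otherwise `N(x,·)` increases on `[ustar, x]`.
  have hend : ∀ z, z ∈ Icc m₁ x → IsMinOn (M.N ψ φ x) (Icc m₁ x) z → M.N ψ φ x z < 0 → z ≠ x := by
    rintro z hz hzmin hz0 rfl
    rcases le_or_gt z M.ustar with hzu | hzu
    · have hnd := netDrift_nonneg (M := M) hx (hzu.trans ustar_le_xbar)
      rw [N_self] at hz0
      have hr := M.r_pos
      have : 0 ≤ M.μ z / M.r - M.U z := by
        have := div_nonneg hnd hr.le
        unfold netDrift at this
        rwa [sub_div, mul_div_cancel_left₀ _ hr.ne'] at this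
      exact absurd hz0 (not_lt.2 (mul_nonneg (D_pos h hx hx).le this))
    · have h1 := hmono M.ustar hu.le le_rfl ⟨le_rfl, hzu.le⟩ ⟨hzu.le, le_rfl⟩ hzu
      exact absurd (hzmin ⟨hu.le, hzu.le⟩) (not_le.2 h1)
  obtain ⟨z, hz, hzmin, hz0⟩ : ∃ z ∈ Ioo m₁ x, IsMinOn (M.N ψ φ x) (Icc m₁ x) z ∧
      M.N ψ φ x z ≤ 0 := by
    obtain ⟨z, hz, hzmin⟩ := isCompact_Icc.exists_isMinOn ⟨m₁, le_rfl, h₁₂.le.trans h₂.le⟩ hcont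
    have hz2 : M.N ψ φ x z ≤ M.N ψ φ x m₂ := hzmin ⟨h₁₂.le, h₂.le⟩
    rcases (hz2.trans hneg).lt_or_eq with hlt | heq
    · refine ⟨z, ⟨hz.1.lt_of_ne ?_, hz.2.lt_of_ne (hend z hz hzmin hlt)⟩, hzmin, hlt.le⟩
      rintro rfl
      exact hlt.ne h0
    · refine ⟨m₂, ⟨h₁₂, h₂⟩, fun t ht => ?_, hneg⟩
      have : M.N ψ φ x z ≤ M.N ψ φ x t := hzmin ht
      exact (hneg.trans heq.ge).trans this
  have hloc : IsLocalMin (M.N ψ φ x) z := hzmin.isLocalMin (Icc_mem_nhds hz.1 hz.2)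
  have hzpos : 0 < z := hm₁.trans_lt hz.1
  rcases lt_or_ge z M.ustar with hzu | hzu
  · exact not_isLocalMin_N h hx hzpos hzu hz0 hloc
  · exact (deriv_N_pos h hzpos.le hzu hz.2).ne' (hloc.hasDerivAt_eq_zero (hasDerivAt_N h x hzpos))

/-! ### The threshold `eta` -/

lemma N_self_nonneg (h : M.IsFundamentalPair ψ φ) {m : ℝ} (hm : m ∈ Icc 0 M.xbar) :
    0 ≤ M.N ψ φ m m := by
  rw [N_self]
  refine mul_nonneg (D_pos h hm.1 hm.1).le ?_
  have hr := M.r_pos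
  have := div_nonneg (netDrift_nonneg hm.1 hm.2) hr.le
  unfold netDrift at this
  rwa [sub_div, mul_div_cancel_left₀ _ hr.ne'] at this

lemma N_self_pos (h : M.IsFundamentalPair ψ φ) {m : ℝ} (hm : m ∈ Ico 0 M.xbar) :
    0 < M.N ψ φ m m := by
  rw [N_self]
  refine mul_pos (D_pos h hm.1 hm.1) ?_
  have hr := M.r_pos
  have := div_pos (netDrift_pos hm.1 hm.2) hr
  unfold netDrift at this
  rwa [sub_div, mul_div_cancel_left₀ _ hr.ne'] at this

lemma N_div_pos_iff (h : M.IsFundamentalPair ψ φ) {x : ℝ} (hx : 0 ≤ x) (m : ℝ) :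
    0 < M.N ψ φ x m / D ψ φ x x ↔ 0 < M.N ψ φ x m :=
  div_pos_iff_of_pos_right (D_pos h hx hx)

lemma N_div_nonneg_iff (h : M.IsFundamentalPair ψ φ) {x : ℝ} (hx : 0 ≤ x) (m : ℝ) :
    0 ≤ M.N ψ φ x m / D ψ φ x x ↔ 0 ≤ M.N ψ φ x m := by
  rw [le_div_iff₀ (D_pos h hx hx), zero_mul]

/-- `eta m`, an infimum of a set of zeros, is the only zero of `N(·,m)` on `[0, ∞)`. -/
lemma eta_spec (h : M.IsFundamentalPair ψ φ) {m : ℝ} (hm : m ∈ Icc 0 M.xbar) :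
    m ≤ M.eta ψ φ m ∧ M.N ψ φ (M.eta ψ φ m) m = 0 := by
  have hW := D_pos h hm.1 hm.1
  obtain ⟨c, hc, hcμ⟩ := M.deriv_μ_lt
  have hr := M.r_pos
  set g : ℝ := 1 - c / M.r with hg
  have hgpos : 0 < g := by
    have := (div_lt_one hr).2 hc
    rw [hg]
    linarith
  set p := M.N ψ φ m m / D ψ φ m m with hp
  have hp0 : 0 ≤ p := div_nonneg (N_self_nonneg h hm) hW.le
  -- The slope of `N / D(x,x)` in `x` is at most `-g` on `[m, ∞)`, which forces a zero.
  have hslope : ∀ x, m ≤ x → M.N ψ φ x m / D ψ φ x x + g * (x - m) ≤ p := by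
    have hanti := antitoneOn_of_hasDerivAt_Ici (a := m)
      (g := fun x => M.N ψ φ x m / D ψ φ x x + g * (x - m))
      (g' := fun x => -(M.G x * (D ψ φ x m / D ψ φ x x)) + g * (1 - 0))
      (fun t ht => (hasDerivAt_N_div h (hm.1.trans ht) m).add
        (((hasDerivAt_id t).sub (hasDerivAt_const t m)).const_mul g)) ?_
    · intro x hx
      have := hanti (mem_Ici.2 le_rfl) (mem_Ici.2 hx) hx
      simpa using this
    · intro t ht
      have ht0 := hm.1.trans ht
      have h1 := monotoneOn_D_div h hm.1 (mem_Ici.2 le_rfl) (mem_Ici.2 ht) ht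
      simp only at h1
      rw [div_self hW.ne'] at h1
      have h2 : g ≤ M.G t := by
        have := div_le_div_of_nonneg_right (hcμ t ht0) hr.le
        rw [hg, G]
        linarith
      have h3 := mul_le_mul h2 h1 zero_le_one (G_pos ht0).le
      linarith
  have hlarge : m ≤ m + p / g := le_add_of_nonneg_right (div_nonneg hp0 hgpos.le)
  have hneg : M.N ψ φ (m + p / g) m / D ψ φ (m + p / g) (m + p / g) ≤ 0 := by
    have := hslope _ hlarge
    rw [add_sub_cancel_left, mul_div_cancel₀ _ hgpos.ne'] at this
    linarith
  obtain ⟨z, hz, hz0⟩ := intermediate_value_Icc' hlarge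
    (f := fun x => M.N ψ φ x m / D ψ φ x x)
    (fun t ht => (hasDerivAt_N_div h (hm.1.trans ht.1) m).continuousAt.continuousWithinAt)
    ⟨hneg, hp0⟩
  have hznn : 0 ≤ z := hm.1.trans hz.1
  have hNz : M.N ψ φ z m = 0 := (div_eq_zero_iff.1 hz0).resolve_right (D_pos h hznn hznn).ne'
  have hset : {x : ℝ | 0 ≤ x ∧ M.N ψ φ x m = 0} = {z} := by
    ext x
    refine ⟨fun ⟨hx, hx0⟩ => ?_, fun hx => ?_⟩
    · exact (strictAntiOn_N_div h hm.1).injOn hx hznn (by simp [hx0, hNz])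
    · rw [mem_singleton_iff.1 hx]
      exact ⟨hznn, hNz⟩
  have : M.eta ψ φ m = z := by
    unfold eta
    rw [hset, csInf_singleton]
  rw [this]
  exact ⟨hz.1, hNz⟩

lemma le_eta (h : M.IsFundamentalPair ψ φ) {m : ℝ} (hm : m ∈ Icc 0 M.xbar) :
    m ≤ M.eta ψ φ m := (eta_spec h hm).1

lemma eta_nonneg (h : M.IsFundamentalPair ψ φ) {m : ℝ} (hm : m ∈ Icc 0 M.xbar) :
    0 ≤ M.eta ψ φ m := hm.1.trans (le_eta h hm)

/-- On `[0, ∞)`, the sign of `N(·,m)` changes from positive to negative at `eta m`. -/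
lemma N_pos_iff_lt_eta (h : M.IsFundamentalPair ψ φ) {x m : ℝ} (hx : 0 ≤ x)
    (hm : m ∈ Icc 0 M.xbar) : 0 < M.N ψ φ x m ↔ x < M.eta ψ φ m := by
  have hη := eta_nonneg h hm
  rw [← N_div_pos_iff h hx, ← (strictAntiOn_N_div h hm.1).lt_iff_gt hη hx]
  simp [(eta_spec h hm).2]

lemma N_nonneg_iff_le_eta (h : M.IsFundamentalPair ψ φ) {x m : ℝ} (hx : 0 ≤ x)
    (hm : m ∈ Icc 0 M.xbar) : 0 ≤ M.N ψ φ x m ↔ x ≤ M.eta ψ φ m := by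
  have hη := eta_nonneg h hm
  rw [← N_div_nonneg_iff h hx, ← (strictAntiOn_N_div h hm.1).le_iff_ge hη hx]
  simp [(eta_spec h hm).2]

lemma eta_xbar (h : M.IsFundamentalPair ψ φ) : M.eta ψ φ M.xbar = M.xbar := by
  have hmem : M.xbar ∈ Icc 0 M.xbar := ⟨xbar_pos.le, le_rfl⟩
  refine le_antisymm ?_ (le_eta h hmem)
  rw [← not_lt, ← N_pos_iff_lt_eta h xbar_pos.le hmem, N_self, not_lt]
  have h0 := (xbar_spec (M := M)).2
  have hr := M.r_pos
  have : M.μ M.xbar / M.r - M.U M.xbar = M.netDrift M.xbar / M.r := by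
    unfold netDrift
    field_simp
  rw [this, h0, zero_div, mul_zero]

lemma lt_eta (h : M.IsFundamentalPair ψ φ) {m : ℝ} (hm : m ∈ Ico 0 M.xbar) :
    m < M.eta ψ φ m :=
  (N_pos_iff_lt_eta h hm.1 ⟨hm.1, hm.2.le⟩).1 (N_self_pos h hm)

/-- If `m₂ < eta m₁`, then `N(eta m₁, m₂) > 0` gives `eta m₁ < eta m₂`; otherwise
`eta m₁ ≤ m₂ ≤ eta m₂`. -/
lemma strictMonoOn_eta (h : M.IsFundamentalPair ψ φ) :
    StrictMonoOn (M.eta ψ φ) (Icc 0 M.xbar) := by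
  have key : ∀ m₁ ∈ Icc 0 M.xbar, ∀ m₂ ∈ Icc 0 M.xbar, m₁ < m₂ → m₂ < M.eta ψ φ m₁ →
      M.eta ψ φ m₁ < M.eta ψ φ m₂ := by
    intro m₁ h₁ m₂ h₂ h12 hlt
    rw [← N_pos_iff_lt_eta h (eta_nonneg h h₁) h₂]
    exact N_pos_of_eq_zero h h₁.1 h12 hlt (eta_spec h h₁).2
  have hweak : ∀ m₁ ∈ Icc 0 M.xbar, ∀ m₂ ∈ Icc 0 M.xbar, m₁ < m₂ →
      M.eta ψ φ m₁ ≤ M.eta ψ φ m₂ := by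
    intro m₁ h₁ m₂ h₂ h12
    rcases lt_or_ge m₂ (M.eta ψ φ m₁) with hlt | hge
    · exact (key m₁ h₁ m₂ h₂ h12 hlt).le
    · exact hge.trans (le_eta h h₂)
  intro m₁ h₁ m₂ h₂ h12
  rcases lt_or_ge m₂ (M.eta ψ φ m₁) with hlt | hge
  · exact key m₁ h₁ m₂ h₂ h12 hlt
  · rcases h₂.2.lt_or_eq with h2x | h2x
    · exact hge.trans_lt (lt_eta h ⟨h₂.1, h2x⟩)
    · -- At the right end the strict increase is passed through an intermediate point.
      obtain ⟨m, hm1, hm2⟩ := exists_between h12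
      have hm : m ∈ Icc 0 M.xbar := ⟨h₁.1.trans hm1.le, hm2.le.trans h₂.2⟩
      refine ((hweak m₁ h₁ m hm hm1).lt_of_ne fun he => ?_).trans_le (hweak m hm m₂ h₂ hm2)
      rcases lt_or_ge m (M.eta ψ φ m₁) with hlt | hge
      · exact (key m₁ h₁ m hm hm1 hlt).ne he
      · exact absurd (lt_eta h ⟨hm.1, hm2.trans_le h₂.2⟩) (not_lt.2 (he ▸ hge))

lemma eta_le_xbar (h : M.IsFundamentalPair ψ φ) {m : ℝ} (hm : m ∈ Icc 0 M.xbar) :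
    M.eta ψ φ m ≤ M.xbar := by
  rw [← eta_xbar h]
  exact (strictMonoOn_eta h).monotoneOn hm ⟨xbar_pos.le, le_rfl⟩ hm.2

lemma eta_lt_xbar (h : M.IsFundamentalPair ψ φ) {m : ℝ} (hm : m ∈ Ico 0 M.xbar) :
    M.eta ψ φ m < M.xbar := by
  have := strictMonoOn_eta h ⟨hm.1, hm.2.le⟩ ⟨xbar_pos.le, le_rfl⟩ hm.2
  rwa [eta_xbar h] at this

lemma eta_zero_pos (h : M.IsFundamentalPair ψ φ) : 0 < M.eta ψ φ 0 :=
  lt_eta h ⟨le_rfl, xbar_pos⟩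

/-- Right continuity of `eta` at the initial point. -/
lemma eventually_eta_lt (h : M.IsFundamentalPair ψ φ) {x : ℝ} (hx : M.eta ψ φ 0 < x) :
    ∀ᶠ m in 𝓝[≥] 0, M.eta ψ φ m < x := by
  have h0 : (0 : ℝ) ∈ Icc 0 M.xbar := ⟨le_rfl, xbar_pos.le⟩
  have hx0 : 0 ≤ x := (eta_zero_pos h).le.trans hx.le
  have hneg : M.N ψ φ x 0 < 0 := by
    rw [← not_le, N_nonneg_iff_le_eta h hx0 h0, not_le]
    exact hx
  filter_upwards [(continuousOn_N_right h x 0 (mem_Ici.2 le_rfl)).eventually_lt_const hneg,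
    Icc_mem_nhdsGE xbar_pos] with m hm hmem
  rwa [← not_le, ← N_nonneg_iff_le_eta h hx0 hmem, not_le]

end Model

/-! ### Bounded functions that are Lipschitz in the first variable -/

/-- `g x p` is bounded for `x ∈ S`, `p ∈ P`, and Lipschitz in `x` uniformly in `p`. -/
def BoundedLipschitz (S P : Set ℝ) (g : ℝ → ℝ → ℝ) : Prop :=
  ∃ C K : ℝ, (∀ p ∈ P, ∀ x ∈ S, |g x p| ≤ C) ∧
    ∀ p ∈ P, ∀ x ∈ S, ∀ y ∈ S, |g x p - g y p| ≤ K * |x - y|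

namespace BoundedLipschitz

variable {S P : Set ℝ} {g g₁ g₂ : ℝ → ℝ → ℝ}

lemma of_left {u : ℝ → ℝ} {a b : ℝ} (hu : ∃ K, LipschitzOnWith K u (Icc a b)) :
    BoundedLipschitz (Icc a b) P (fun x _ => u x) := by
  obtain ⟨K, hK⟩ := hu
  obtain ⟨C, hC⟩ := isCompact_Icc.exists_bound_of_continuousOn hK.continuousOn
  refine ⟨C, K, fun p _ x hx => hC x hx, fun p _ x hx y hy => ?_⟩
  have := hK.dist_le_mul x hx y hy
  rwa [Real.dist_eq, Real.dist_eq] at this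

lemma of_right {u : ℝ → ℝ} (hu : ∃ C, ∀ p ∈ P, |u p| ≤ C) :
    BoundedLipschitz S P (fun _ p => u p) := by
  obtain ⟨C, hC⟩ := hu
  exact ⟨C, 0, fun p hp _ _ => hC p hp, fun p _ x _ y _ => by simp⟩

lemma sub (h₁ : BoundedLipschitz S P g₁) (h₂ : BoundedLipschitz S P g₂) :
    BoundedLipschitz S P (fun x p => g₁ x p - g₂ x p) := by
  obtain ⟨C₁, K₁, hC₁, hK₁⟩ := h₁
  obtain ⟨C₂, K₂, hC₂, hK₂⟩ := h₂
  refine ⟨C₁ + C₂, K₁ + K₂, fun p hp x hx => ?_, fun p hp x hx y hy => ?_⟩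
  · exact (abs_sub _ _).trans (add_le_add (hC₁ p hp x hx) (hC₂ p hp x hx))
  · have := abs_sub (g₁ x p - g₁ y p) (g₂ x p - g₂ y p)
    rw [show g₁ x p - g₂ x p - (g₁ y p - g₂ y p) =
      g₁ x p - g₁ y p - (g₂ x p - g₂ y p) by ring]
    linarith [hK₁ p hp x hx y hy, hK₂ p hp x hx y hy]

lemma mul (h₁ : BoundedLipschitz S P g₁) (h₂ : BoundedLipschitz S P g₂) :
    BoundedLipschitz S P (fun x p => g₁ x p * g₂ x p) := by
  obtain ⟨C₁, K₁, hC₁, hK₁⟩ := h₁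
  obtain ⟨C₂, K₂, hC₂, hK₂⟩ := h₂
  refine ⟨C₁ * C₂, C₁ * K₂ + K₁ * C₂, fun p hp x hx => ?_, fun p hp x hx y hy => ?_⟩
  · rw [abs_mul]
    exact mul_le_mul (hC₁ p hp x hx) (hC₂ p hp x hx) (abs_nonneg _)
      ((abs_nonneg _).trans (hC₁ p hp x hx))
  · have h3 : |g₁ x p * (g₂ x p - g₂ y p)| ≤ C₁ * (K₂ * |x - y|) := by
      rw [abs_mul]
      exact mul_le_mul (hC₁ p hp x hx) (hK₂ p hp x hx y hy) (abs_nonneg _)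
        ((abs_nonneg _).trans (hC₁ p hp x hx))
    have h4 : |(g₁ x p - g₁ y p) * g₂ y p| ≤ K₁ * |x - y| * C₂ := by
      rw [abs_mul]
      exact mul_le_mul (hK₁ p hp x hx y hy) (hC₂ p hp y hy) (abs_nonneg _)
        ((abs_nonneg _).trans (hK₁ p hp x hx y hy))
    rw [show g₁ x p * g₂ x p - g₁ y p * g₂ y p =
      g₁ x p * (g₂ x p - g₂ y p) + (g₁ x p - g₁ y p) * g₂ y p by ring]
    have := abs_add_le (g₁ x p * (g₂ x p - g₂ y p)) ((g₁ x p - g₁ y p) * g₂ y p)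
    linarith

lemma inv (h : BoundedLipschitz S P g) {c : ℝ} (hc : 0 < c)
    (hg : ∀ p ∈ P, ∀ x ∈ S, c ≤ g x p) : BoundedLipschitz S P (fun x p => (g x p)⁻¹) := by
  obtain ⟨C, K, hC, hK⟩ := h
  refine ⟨c⁻¹, K * (c⁻¹ * c⁻¹), fun p hp x hx => ?_, fun p hp x hx y hy => ?_⟩
  · have h0 := hg p hp x hx
    rw [abs_inv, abs_of_pos (hc.trans_le h0)]
    exact inv_anti₀ hc h0
  · have hx0 := hc.trans_le (hg p hp x hx)
    have hy0 := hc.trans_le (hg p hp y hy)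
    rw [inv_sub_inv hx0.ne' hy0.ne', div_eq_mul_inv, mul_inv, abs_mul, abs_sub_comm, abs_mul,
      abs_inv, abs_inv, abs_of_pos hx0, abs_of_pos hy0]
    have h1 := inv_anti₀ hc (hg p hp x hx)
    have h2 := inv_anti₀ hc (hg p hp y hy)
    have h3 : (g x p)⁻¹ * (g y p)⁻¹ ≤ c⁻¹ * c⁻¹ :=
      mul_le_mul h1 h2 (inv_pos.2 hy0).le (inv_pos.2 hc).le
    have h4 := mul_le_mul (hK p hp x hx y hy) h3
      (mul_pos (inv_pos.2 hx0) (inv_pos.2 hy0)).le ((abs_nonneg _).trans (hK p hp x hx y hy))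
    linarith

end BoundedLipschitz

lemma exists_lipschitzOnWith_Icc {u u' : ℝ → ℝ} {a b : ℝ}
    (hd : ∀ x ∈ Icc a b, HasDerivAt u (u' x) x) (hc : ContinuousOn u' (Icc a b)) :
    ∃ K, LipschitzOnWith K u (Icc a b) := by
  obtain ⟨C, hC⟩ := isCompact_Icc.exists_bound_of_continuousOn hc
  refine ⟨C.toNNReal, (convex_Icc a b).lipschitzOnWith_of_nnnorm_hasDerivWithin_le
    (fun x hx => (hd x hx).hasDerivWithinAt) fun x hx => ?_⟩
  rw [← NNReal.coe_le_coe, coe_nnnorm]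
  exact (hC x hx).trans (Real.le_coe_toNNReal C)

namespace Model

variable {M : Model} {ψ φ : ℝ → ℝ}

/-! ### The hazard rate -/

lemma continuousOn_f : ContinuousOn M.f (Icc 0 M.ybar) :=
  M.f_lipschitz.choose_spec.continuousOn

lemma F_pos {m : ℝ} (hm : m ∈ Ioc 0 M.ybar) : 0 < M.F m := by
  have := M.Q_prob
  obtain ⟨z, hz, hmin⟩ := isCompact_Icc.exists_isMinOn ⟨0, le_rfl, M.ybar_pos.le⟩
    (continuousOn_f (M := M))
  have hfz := M.f_pos z hz
  have hsub : Ioc 0 m ⊆ stateSpace M.α := fun x hx => mem_stateSpace hx.1.le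
  have hQ : 0 < M.Q (Ioc 0 m) := by
    rw [M.Q_density, withDensity_apply _ measurableSet_Ioc,
      Measure.restrict_restrict measurableSet_Ioc, inter_eq_left.2 hsub]
    have hle : ∫⁻ _ in Ioc 0 m, ENNReal.ofReal (M.f z) ≤
        ∫⁻ x in Ioc 0 m, ENNReal.ofReal (M.f x) :=
      setLIntegral_mono' measurableSet_Ioc fun x hx =>
        ENNReal.ofReal_le_ofReal (hmin ⟨hx.1.le, hx.2.trans hm.2⟩)
    refine lt_of_lt_of_le ?_ hle
    rw [setLIntegral_const, Real.volume_Ioc]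
    exact ENNReal.mul_pos (ENNReal.ofReal_pos.2 hfz).ne'
      (ENNReal.ofReal_pos.2 (by linarith [hm.1])).ne'
  have h2 := hQ.trans_le (measure_mono (Ioc_subset_Iic_self (a := 0) (b := m)))
  rw [← ProbabilityTheory.ofReal_cdf] at h2
  exact ENNReal.ofReal_pos.1 h2

/-- The law of the tipping point has a density, hence no atoms. -/
lemma continuous_F : Continuous M.F := by
  have := M.Q_prob
  rw [continuous_iff_continuousAt]
  intro m
  have hmono : Monotone M.F := ProbabilityTheory.monotone_cdf M.Q
  rw [hmono.continuousAt_iff_leftLim_eq_rightLim]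
  have hatom : M.Q {m} = 0 := by
    rw [M.Q_density]
    apply withDensity_absolutelyContinuous
    exact le_antisymm ((Measure.restrict_apply_le _ _).trans (by simp)) bot_le
  rw [← ProbabilityTheory.measure_cdf M.Q, StieltjesFunction.measure_singleton,
    ENNReal.ofReal_eq_zero] at hatom
  have hl : Function.leftLim M.F m = M.F m := by
    refine le_antisymm (hmono.leftLim_le le_rfl) ?_
    have : M.F m - Function.leftLim M.F m ≤ 0 := hatom
    linarith
  rw [hl]
  exact ((ProbabilityTheory.cdf M.Q).rightLim_eq m).symm

lemma continuousOn_H : ContinuousOn M.H (Ioc 0 M.ybar) :=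
  (continuousOn_f.mono Ioc_subset_Icc_self).div continuous_F.continuousOn
    fun _ hm => (F_pos hm).ne'

lemma H_pos {m : ℝ} (hm : m ∈ Ioc 0 M.ybar) : 0 < M.H m :=
  div_pos (M.f_pos m ⟨hm.1.le, hm.2⟩) (F_pos hm)

lemma antitoneOn_H : AntitoneOn M.H (Ioc 0 M.ybar) := M.hazard

/-! ### The vector field `E` -/

/-- The end of the interval on which the differential equation is imposed. -/
noncomputable def horizon (M : Model) : ℝ := min M.xbar M.ybar

lemma horizon_pos : 0 < M.horizon := lt_min xbar_pos M.ybar_pos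

lemma horizon_le_xbar : M.horizon ≤ M.xbar := min_le_left _ _

lemma horizon_le_ybar : M.horizon ≤ M.ybar := min_le_right _ _

lemma mem_Icc_xbar {m : ℝ} (hm : m ∈ Ioc 0 M.horizon) : m ∈ Icc 0 M.xbar :=
  ⟨hm.1.le, hm.2.trans horizon_le_xbar⟩

lemma mem_Ioc_ybar {m : ℝ} (hm : m ∈ Ioc 0 M.horizon) : m ∈ Ioc 0 M.ybar :=
  ⟨hm.1, hm.2.trans horizon_le_ybar⟩

lemma E_nonneg (h : M.IsFundamentalPair ψ φ) {x m : ℝ} (hm : m ∈ Ioc 0 M.horizon) (hx : 0 ≤ x)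
    (hxη : x ≤ M.eta ψ φ m) : 0 ≤ M.E ψ φ x m :=
  mul_nonneg (div_nonneg (H_pos (mem_Ioc_ybar hm)).le (G_pos hx).le)
    (div_nonneg ((N_nonneg_iff_le_eta h hx (mem_Icc_xbar hm)).2 hxη) (D_pos h hx hm.1.le).le)

lemma E_nonpos (h : M.IsFundamentalPair ψ φ) {x m : ℝ} (hm : m ∈ Ioc 0 M.horizon)
    (hxη : M.eta ψ φ m ≤ x) : M.E ψ φ x m ≤ 0 := by
  have hx : 0 ≤ x := (eta_nonneg h (mem_Icc_xbar hm)).trans hxη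
  have hN : M.N ψ φ x m ≤ 0 := by
    rw [← not_lt, N_pos_iff_lt_eta h hx (mem_Icc_xbar hm), not_lt]
    exact hxη
  exact mul_nonpos_of_nonneg_of_nonpos
    (div_nonneg (H_pos (mem_Ioc_ybar hm)).le (G_pos hx).le)
    (div_nonpos_of_nonpos_of_nonneg hN (D_pos h hx hm.1.le).le)

/-- Between the diagonal and `eta`, the numerator of `E` decreases in `x` and its denominator
increases, once both are divided by the Wronskian. -/
lemma E_anti (h : M.IsFundamentalPair ψ φ) {x y m : ℝ} (hm : m ∈ Ioc 0 M.horizon) (hmx : m ≤ x)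
    (hxy : x ≤ y) (hyη : y ≤ M.eta ψ φ m) : M.E ψ φ y m ≤ M.E ψ φ x m := by
  have hm0 := hm.1.le
  have hx : 0 ≤ x := hm0.trans hmx
  have hy : 0 ≤ y := hx.trans hxy
  have hmem := mem_Icc_xbar hm
  have hrw : ∀ z, 0 ≤ z → M.E ψ φ z m = M.H m *
      ((M.N ψ φ z m / D ψ φ z z) / (M.G z * (D ψ φ z m / D ψ φ z z))) := by
    intro z hz
    have h1 := D_pos h hz hz
    have h2 := D_pos h hz hm0
    have h3 := G_pos (M := M) hz
    unfold E
    field_simp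
  rw [hrw x hx, hrw y hy]
  apply mul_le_mul_of_nonneg_left _ (H_pos (mem_Ioc_ybar hm)).le
  have hDx := div_pos (D_pos h hx hm0) (D_pos h hx hx)
  apply div_le_div₀
  · exact (N_div_nonneg_iff h hx m).2 ((N_nonneg_iff_le_eta h hx hmem).2 (hxy.trans hyη))
  · exact (strictAntiOn_N_div h hm0).antitoneOn hx hy hxy
  · exact mul_pos (G_pos hx) hDx
  · exact mul_le_mul (monotoneOn_G hx hy hxy)
      (monotoneOn_D_div h hm0 (mem_Ici.2 hmx) (mem_Ici.2 (hmx.trans hxy)) hxy) hDx.le (G_pos hy).le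

/-- On the diagonal `E` is a product of nonincreasing factors: the hazard rate, `μ - r U`, and
the reciprocal of `r - μ'`. -/
lemma E_diag_anti (h : M.IsFundamentalPair ψ φ) {m n : ℝ} (hm : m ∈ Ioc 0 M.horizon)
    (hn : n ∈ Ioc 0 M.horizon) (hmn : m ≤ n) : M.E ψ φ n n ≤ M.E ψ φ m m := by
  have hr := M.r_pos
  have hrw : ∀ z, 0 ≤ z → M.E ψ φ z z = M.H z * (M.netDrift z / (M.r * M.G z)) := by
    intro z hz
    have h1 := D_pos h hz hz
    have h3 := G_pos (M := M) hz
    unfold E netDrift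
    rw [N_self]
    field_simp
  rw [hrw m hm.1.le, hrw n hn.1.le]
  have hGm := G_pos (M := M) hm.1.le
  have hGn := G_pos (M := M) hn.1.le
  have hnm := netDrift_nonneg hm.1.le (mem_Icc_xbar hm).2
  have hnn := netDrift_nonneg hn.1.le (mem_Icc_xbar hn).2
  apply mul_le_mul (antitoneOn_H (mem_Ioc_ybar hm) (mem_Ioc_ybar hn) hmn) _ (by positivity)
    (H_pos (mem_Ioc_ybar hm)).le
  apply div_le_div₀ hnm (strictAntiOn_netDrift.antitoneOn hm.1.le hn.1.le hmn) (by positivity)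
  exact mul_le_mul_of_nonneg_left (monotoneOn_G hm.1.le hn.1.le hmn) hr.le

lemma SolvesHomogeneous.continuousOn {u : ℝ → ℝ} (hu : M.SolvesHomogeneous u) :
    ContinuousOn u (Ici 0) := fun _ hx => (hu.hasDerivAt hx).continuousAt.continuousWithinAt

lemma SolvesHomogeneous.continuousOn_deriv {u : ℝ → ℝ} (hu : M.SolvesHomogeneous u) :
    ContinuousOn (deriv u) (Ici 0) :=
  fun _ hx => (hu.hasDerivAt_deriv hx).continuousAt.continuousWithinAt

lemma SolvesHomogeneous.lipschitz {u : ℝ → ℝ} (hu : M.SolvesHomogeneous u) (b : ℝ) :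
    ∃ K, LipschitzOnWith K u (Icc 0 b) :=
  exists_lipschitzOnWith_Icc (fun _ hx => hu.hasDerivAt hx.1)
    (hu.continuousOn_deriv.mono Icc_subset_Ici_self)

lemma SolvesHomogeneous.lipschitz_deriv {u : ℝ → ℝ} (hu : M.SolvesHomogeneous u) (b : ℝ) :
    ∃ K, LipschitzOnWith K (deriv u) (Icc 0 b) := by
  refine exists_lipschitzOnWith_Icc (fun _ hx => hu.hasDerivAt_deriv hx.1) ?_
  have hσ : ContinuousOn M.σ (Icc 0 b) :=
    M.σ_contDiff.continuousOn.mono fun _ hx => mem_stateSpace hx.1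
  have hsub : Icc 0 b ⊆ Ici (0 : ℝ) := Icc_subset_Ici_self
  refine (continuousOn_const.div (hσ.pow 2) fun x hx => ?_).mul
    ((continuousOn_const.mul (hu.continuousOn.mono hsub)).sub
      ((continuousOn_μ.mono hsub).mul (hu.continuousOn_deriv.mono hsub)))
  exact (pow_pos (M.σ_pos x (mem_stateSpace hx.1)) 2).ne'

lemma exists_bound_Icc {u : ℝ → ℝ} (hu : ContinuousOn u (Ici 0)) (b : ℝ) :
    ∃ C, ∀ p ∈ Icc 0 b, |u p| ≤ C :=
  isCompact_Icc.exists_bound_of_continuousOn (hu.mono Icc_subset_Ici_self)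

/-- Away from the singularity at `m = 0`, `E` is Lipschitz in its first argument. -/
lemma boundedLipschitz_E (h : M.IsFundamentalPair ψ φ) {ε : ℝ} (hε : 0 < ε) :
    BoundedLipschitz (Icc 0 M.xbar) (Icc ε M.horizon) (M.E ψ φ) := by
  have hP : ∀ p ∈ Icc ε M.horizon, p ∈ Ioc 0 M.horizon := fun p hp => ⟨hε.trans_le hp.1, hp.2⟩
  have right : ∀ {u : ℝ → ℝ}, ContinuousOn u (Ici 0) →
      BoundedLipschitz (Icc 0 M.xbar) (Icc ε M.horizon) (fun _ p => u p) := by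
    intro u hu
    obtain ⟨C, hC⟩ := exists_bound_Icc hu M.horizon
    exact .of_right ⟨C, fun p hp => hC p ⟨(hP p hp).1.le, hp.2⟩⟩
  have rψ := right h.solves_ψ.continuousOn
  have rφ := right h.solves_φ.continuousOn
  have rU := right (continuousOn_U (M := M))
  have rH : BoundedLipschitz (Icc 0 M.xbar) (Icc ε M.horizon) (fun _ p => M.H p) := by
    refine .of_right ⟨M.H ε, fun p hp => ?_⟩
    have hp' := mem_Ioc_ybar (hP p hp)
    rw [abs_of_pos (H_pos hp')]
    exact antitoneOn_H ⟨hε, hp.1.trans hp'.2⟩ hp' hp.1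
  have lip : ∀ {u : ℝ → ℝ}, (∃ K, LipschitzOnWith K u (Icc 0 M.xbar)) →
      BoundedLipschitz (Icc 0 M.xbar) (Icc ε M.horizon) (fun x _ => u x) := .of_left
  have lψ := lip (h.solves_ψ.lipschitz _)
  have lφ := lip (h.solves_φ.lipschitz _)
  have lψ' := lip (h.solves_ψ.lipschitz_deriv _)
  have lφ' := lip (h.solves_φ.lipschitz_deriv _)
  have hsub : Icc 0 M.xbar ⊆ stateSpace M.α := fun x hx => mem_stateSpace hx.1
  have lμ := lip (M.μ_lipschitz.imp fun K hK => hK.mono hsub)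
  have lμ' := lip (M.deriv_μ_lipschitz.imp fun K hK => hK.mono hsub)
  have one : ∀ c : ℝ, BoundedLipschitz (Icc 0 M.xbar) (Icc ε M.horizon) (fun _ _ => c) :=
    fun c => .of_right ⟨|c|, fun _ _ => le_rfl⟩
  have hD := (lψ'.mul rφ).sub (lφ'.mul rψ)
  have hW := (lψ'.mul lφ).sub (lφ'.mul lψ)
  have hG := (one 1).sub (lμ'.mul (one M.r⁻¹))
  have hN := ((lφ.mul rψ).sub (lψ.mul rφ)).sub
    (((one 0).sub (hD.mul (lμ.mul (one M.r⁻¹))))) |>.sub (hW.mul rU)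
  obtain ⟨z, hz, hmin⟩ := isCompact_Icc.exists_isMinOn (⟨0, le_rfl, xbar_pos.le⟩ :
    (Icc 0 M.xbar).Nonempty) (h.solves_ψ.continuousOn_deriv.mono Icc_subset_Ici_self)
  have hzpos := deriv_ψ_pos h hz.1
  have hφpos := h.pos_φ M.xbar (mem_stateSpace xbar_pos.le)
  have hDinv := hD.inv (c := deriv ψ z * φ M.xbar) (mul_pos hzpos hφpos) (by
    intro p hp x hx
    have h1 : deriv ψ z ≤ deriv ψ x := hmin hx
    have hp' := mem_Icc_xbar (hP p hp)
    have h2 := h.decreasing_φ.antitoneOn (mem_stateSpace hp'.1)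
      (mem_stateSpace xbar_pos.le) hp'.2
    have h3 := mul_le_mul h1 h2 hφpos.le (hzpos.le.trans h1)
    have h4 := mul_neg_of_neg_of_pos (deriv_φ_neg h hx.1) (h.pos_ψ p (mem_stateSpace hp'.1))
    linarith)
  have hGinv := hG.inv (c := M.G 0) (G_pos le_rfl) (by
    intro p hp x hx
    have := monotoneOn_G (M := M) (mem_Ici.2 le_rfl) (mem_Ici.2 hx.1) hx.1
    unfold G at this ⊢
    simpa only [div_eq_mul_inv] using this)
  have hE := (rH.mul hGinv).mul (hN.mul hDinv)
  convert hE using 3 with x m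
  unfold E N G D
  simp only [div_eq_mul_inv]
  ring

lemma continuousOn_E_comp (h : M.IsFundamentalPair ψ φ) {b : ℝ → ℝ} {S : Set ℝ}
    (hS : S ⊆ Ioc 0 M.horizon) (hb : ContinuousOn b S) (hb0 : ∀ m ∈ S, 0 ≤ b m) :
    ContinuousOn (fun m => M.E ψ φ (b m) m) S := by
  have left : ∀ {u : ℝ → ℝ}, ContinuousOn u (Ici 0) → ContinuousOn (fun m => u (b m)) S :=
    fun hu => hu.comp hb hb0
  have right : ∀ {u : ℝ → ℝ}, ContinuousOn u (Ici 0) → ContinuousOn u S :=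
    fun hu => hu.mono fun m hm => (hS hm).1.le
  have lψ := left h.solves_ψ.continuousOn
  have lφ := left h.solves_φ.continuousOn
  have lψ' := left h.solves_ψ.continuousOn_deriv
  have lφ' := left h.solves_φ.continuousOn_deriv
  have rψ := right h.solves_ψ.continuousOn
  have rφ := right h.solves_φ.continuousOn
  have hD : ContinuousOn (fun m => D ψ φ (b m) m) S := (lψ'.mul rφ).sub (lφ'.mul rψ)
  have hW : ContinuousOn (fun m => D ψ φ (b m) (b m)) S := (lψ'.mul lφ).sub (lφ'.mul lψ)
  have hN : ContinuousOn (fun m => M.N ψ φ (b m) m) S :=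
    ((((lφ.mul rψ).sub (lψ.mul rφ)).add (hD.mul ((left (continuousOn_μ (M := M))).div_const _))).sub
      (hW.mul (right (continuousOn_U (M := M)))))
  exact ((continuousOn_H.mono fun m hm => mem_Ioc_ybar (hS hm)).div
    (left (continuousOn_G (M := M))) fun m hm => (G_pos (hb0 m hm)).ne').mul
    (hN.div hD fun m hm => (D_pos h (hb0 m hm) (hS hm).1.le).ne')

/-! ### Barriers and uniqueness -/

/-- Each level `eta m` is a barrier on `[a, m]`, because `eta` increases: a curve that does not
increase while it is above `eta` stays below `eta`. -/
lemma le_eta_of_deriv_nonpos (h : M.IsFundamentalPair ψ φ) {b : ℝ → ℝ} {a : ℝ} (ha : 0 ≤ a)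
    (hb : ContinuousOn b (Icc a M.horizon)) (hba : b a ≤ M.eta ψ φ a)
    (hd : ∀ t ∈ Ioo a M.horizon, M.eta ψ φ t < b t → ∃ d ≤ 0, HasDerivAt b d t) :
    ∀ m ∈ Icc a M.horizon, b m ≤ M.eta ψ φ m := by
  intro m hm
  have hmono := (strictMonoOn_eta h).monotoneOn
  have hmx : m ≤ M.xbar := hm.2.trans horizon_le_xbar
  have hm0 : 0 ≤ m := ha.trans hm.1
  refine le_of_deriv_nonpos_above (c := M.eta ψ φ m) (hb.mono (Icc_subset_Icc_right hm.2))
    (hba.trans (hmono ⟨ha, hm.1.trans hmx⟩ ⟨hm0, hmx⟩ hm.1)) (fun t ht hlt => ?_) m ⟨hm.1, le_rfl⟩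
  refine hd t ⟨ht.1, ht.2.trans_le hm.2⟩ (lt_of_le_of_lt ?_ hlt)
  exact hmono ⟨ha.trans ht.1.le, ht.2.le.trans hmx⟩ ⟨hm0, hmx⟩ ht.2.le

/-- A solution of the singular Cauchy problem on the interval `[0, xbar ∧ ybar]` on which the
differential equation is imposed. -/
structure IsSolutionToHorizon (M : Model) (ψ φ b : ℝ → ℝ) : Prop where
  continuousOn : ContinuousOn b (Icc 0 M.horizon)
  nonneg : ∀ m ∈ Icc 0 M.horizon, 0 ≤ b m
  initial : b 0 = M.eta ψ φ 0
  ode : ∀ m ∈ Ioo 0 M.horizon, HasDerivAt b (M.E ψ φ (b m) m) m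

namespace IsSolutionToHorizon

variable {b b₁ b₂ : ℝ → ℝ}

lemma le_eta (h : M.IsFundamentalPair ψ φ) (hb : M.IsSolutionToHorizon ψ φ b) :
    ∀ m ∈ Icc 0 M.horizon, b m ≤ M.eta ψ φ m :=
  le_eta_of_deriv_nonpos h le_rfl hb.continuousOn hb.initial.le fun t ht hlt =>
    ⟨_, E_nonpos h ⟨ht.1, ht.2.le⟩ hlt.le, hb.ode t ht⟩

lemma monotoneOn (h : M.IsFundamentalPair ψ φ) (hb : M.IsSolutionToHorizon ψ φ b) :
    MonotoneOn b (Icc 0 M.horizon) :=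
  monotoneOn_Icc_of_hasDerivAt hb.continuousOn hb.ode fun t ht =>
    E_nonneg h ⟨ht.1, ht.2.le⟩ (hb.nonneg t ⟨ht.1.le, ht.2.le⟩)
      (hb.le_eta h t ⟨ht.1.le, ht.2.le⟩)

lemma eta_zero_le (h : M.IsFundamentalPair ψ φ) (hb : M.IsSolutionToHorizon ψ φ b) {m : ℝ}
    (hm : m ∈ Icc 0 M.horizon) : M.eta ψ φ 0 ≤ b m := by
  rw [← hb.initial]
  exact hb.monotoneOn h ⟨le_rfl, horizon_pos.le⟩ hm hm.1

lemma mem_Icc (h : M.IsFundamentalPair ψ φ) (hb : M.IsSolutionToHorizon ψ φ b) {m : ℝ}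
    (hm : m ∈ Icc 0 M.horizon) : b m ∈ Icc 0 M.xbar :=
  ⟨hb.nonneg m hm, (hb.le_eta h m hm).trans (eta_le_xbar h ⟨hm.1, hm.2.trans horizon_le_xbar⟩)⟩

/-- Near `0` solutions lie between the diagonal and `eta`, where `E` is nonincreasing in `x`; hence
the distance of two solutions does not increase there. Away from `0` the field is Lipschitz. -/
lemma eqOn (h : M.IsFundamentalPair ψ φ) (hb₁ : M.IsSolutionToHorizon ψ φ b₁)
    (hb₂ : M.IsSolutionToHorizon ψ φ b₂) : EqOn b₁ b₂ (Icc 0 M.horizon) := by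
  set δ := min (M.eta ψ φ 0) M.horizon with hδ
  have hδ0 : 0 < δ := lt_min (eta_zero_pos h) horizon_pos
  have hδη : δ ≤ M.eta ψ φ 0 := min_le_left _ _
  have hδT : δ ≤ M.horizon := min_le_right _ _
  have hsub : Icc 0 δ ⊆ Icc 0 M.horizon := Icc_subset_Icc_right hδT
  have hmono : MonotoneOn (fun t => -(b₁ t - b₂ t) ^ 2) (Icc 0 δ) := by
    apply monotoneOn_Icc_of_hasDerivAt
      (g' := fun t => -(2 * (b₁ t - b₂ t) * (M.E ψ φ (b₁ t) t - M.E ψ φ (b₂ t) t)))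
      (((hb₁.continuousOn.sub hb₂.continuousOn).pow 2).neg.mono hsub)
    · intro t ht
      have ht' : t ∈ Ioo 0 M.horizon := ⟨ht.1, ht.2.trans_le hδT⟩
      refine (((hb₁.ode t ht').sub (hb₂.ode t ht')).pow 2).neg.congr_deriv ?_
      norm_num
    · intro t ht
      have htT : t ∈ Icc 0 M.horizon := hsub ⟨ht.1.le, ht.2.le⟩
      have htI : t ∈ Ioc 0 M.horizon := ⟨ht.1, htT.2⟩
      have h1 := (ht.2.le.trans hδη).trans (hb₁.eta_zero_le h htT)
      have h2 := (ht.2.le.trans hδη).trans (hb₂.eta_zero_le h htT)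
      rcases le_total (b₁ t) (b₂ t) with hle | hle
      · have := E_anti h htI h1 hle (hb₂.le_eta h t htT)
        nlinarith [mul_nonneg (sub_nonneg.2 hle) (sub_nonneg.2 this)]
      · have := E_anti h htI h2 hle (hb₁.le_eta h t htT)
        nlinarith [mul_nonneg (sub_nonneg.2 hle) (sub_nonneg.2 this)]
  have hnear : ∀ m ∈ Icc 0 δ, b₁ m = b₂ m := by
    intro m hm
    have := hmono ⟨le_rfl, hδ0.le⟩ hm hm.1
    simp only [hb₁.initial, hb₂.initial, sub_self] at this
    nlinarith [sq_nonneg (b₁ m - b₂ m), pow_eq_zero_iff (two_ne_zero) (a := b₁ m - b₂ m)]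
  intro m hm
  rcases le_total m δ with hmδ | hmδ
  · exact hnear m ⟨hm.1, hmδ⟩
  obtain ⟨-, K, -, hK⟩ := boundedLipschitz_E h hδ0
  have hsub' : Icc δ m ⊆ Icc 0 M.horizon := Icc_subset_Icc hδ0.le hm.2
  have := (sq_sub_le_of_deriv_sub_le (u := b₁) (v := b₂) (K := K) hmδ
    (hb₁.continuousOn.mono hsub') (hb₂.continuousOn.mono hsub')
    (fun t ht => hb₁.ode t ⟨hδ0.trans ht.1, ht.2.trans_le hm.2⟩)
    (fun t ht => hb₂.ode t ⟨hδ0.trans ht.1, ht.2.trans_le hm.2⟩)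
    (fun t ht => hK t ⟨ht.1.le, ht.2.le.trans hm.2⟩ _
      (hb₁.mem_Icc h (hsub' ⟨ht.1.le, ht.2.le⟩)) _
      (hb₂.mem_Icc h (hsub' ⟨ht.1.le, ht.2.le⟩)))).2
  rw [hnear δ ⟨hδ0.le, le_rfl⟩, sub_self, zero_pow two_ne_zero, zero_mul] at this
  exact sub_eq_zero.1 (pow_eq_zero_iff two_ne_zero |>.1 (le_antisymm this (sq_nonneg _)))

end IsSolutionToHorizon

/-! ### Existence -/

/-- The vector field `E` with its first argument projected to `[0, xbar]`; it is globally
Lipschitz in `x`, uniformly for `m` away from `0`. -/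
noncomputable def clampedE (M : Model) (ψ φ : ℝ → ℝ) (m x : ℝ) : ℝ :=
  M.E ψ φ (projIcc 0 M.xbar xbar_pos.le x) m

lemma clampedE_of_mem {x : ℝ} (hx : x ∈ Icc 0 M.xbar) (m : ℝ) :
    M.clampedE ψ φ m x = M.E ψ φ x m := by
  rw [clampedE, projIcc_of_mem _ hx]

lemma exists_bound_clampedE (h : M.IsFundamentalPair ψ φ) {ε : ℝ} (hε : 0 < ε) :
    ∃ L K : NNReal, ∀ m ∈ Icc ε M.horizon, (∀ x, |M.clampedE ψ φ m x| ≤ L) ∧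
      ∀ x y, |M.clampedE ψ φ m x - M.clampedE ψ φ m y| ≤ K * |x - y| := by
  obtain ⟨C, K, hC, hK⟩ := boundedLipschitz_E h hε
  refine ⟨C.toNNReal, K.toNNReal, fun m hm => ⟨fun x => ?_, fun x y => ?_⟩⟩
  · exact (hC m hm _ (projIcc 0 M.xbar xbar_pos.le x).2).trans (Real.le_coe_toNNReal C)
  · have h1 := hK m hm _ (projIcc 0 M.xbar xbar_pos.le x).2 _ (projIcc 0 M.xbar xbar_pos.le y).2
    have h2 : |(projIcc 0 M.xbar xbar_pos.le x : ℝ) - projIcc 0 M.xbar xbar_pos.le y| ≤ |x - y| :=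
      abs_projIcc_sub_projIcc xbar_pos.le
    exact h1.trans (mul_le_mul (Real.le_coe_toNNReal K) h2 (abs_nonneg _) (NNReal.coe_nonneg _))

/-- The curve `y` solves the differential equation of the clamped field on `[ε, xbar ∧ ybar]`. -/
def IsClampedCurve (M : Model) (ψ φ : ℝ → ℝ) (ε : ℝ) (y : ℝ → ℝ) : Prop :=
  ∀ t ∈ Icc ε M.horizon, HasDerivWithinAt y (M.clampedE ψ φ t (y t)) (Icc ε M.horizon) t

lemma IsClampedCurve.continuousOn {ε : ℝ} {y : ℝ → ℝ} (hy : M.IsClampedCurve ψ φ ε y) :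
    ContinuousOn y (Icc ε M.horizon) := fun t ht => (hy t ht).continuousWithinAt

lemma IsClampedCurve.hasDerivAt {ε : ℝ} {y : ℝ → ℝ} (hy : M.IsClampedCurve ψ φ ε y) {t : ℝ}
    (ht : t ∈ Ioo ε M.horizon) : HasDerivAt y (M.clampedE ψ φ t (y t)) t :=
  (hy t ⟨ht.1.le, ht.2.le⟩).hasDerivAt (Icc_mem_nhds ht.1 ht.2)

lemma exists_isClampedCurve (h : M.IsFundamentalPair ψ φ) {ε : ℝ} (hε : 0 < ε)
    {t₀ : ℝ} (ht₀ : t₀ ∈ Icc ε M.horizon) (x₀ : ℝ) :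
    ∃ y : ℝ → ℝ, y t₀ = x₀ ∧ M.IsClampedCurve ψ φ ε y := by
  obtain ⟨L, K, hLK⟩ := exists_bound_clampedE h hε
  have hT : 0 ≤ M.horizon - ε := sub_nonneg.2 (ht₀.1.trans ht₀.2)
  have hpl : IsPicardLindelof (M.clampedE ψ φ) (⟨t₀, ht₀⟩ : Icc ε M.horizon) x₀
      (L * (M.horizon - ε).toNNReal) 0 L K := by
    refine ⟨fun t ht => ?_, fun x _ => ?_, fun t ht x _ => (hLK t ht).1 x, ?_⟩
    · exact (LipschitzWith.of_dist_le_mul fun x y => (hLK t ht).2 x y).lipschitzOnWith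
    · exact continuousOn_E_comp h (b := fun _ => (projIcc 0 M.xbar xbar_pos.le x : ℝ))
        (fun m hm => ⟨hε.trans_le hm.1, hm.2⟩) continuousOn_const
        fun _ _ => (projIcc 0 M.xbar xbar_pos.le x).2.1
    · have : max (M.horizon - t₀) (t₀ - ε) ≤ M.horizon - ε :=
        max_le (by linarith [ht₀.1]) (by linarith [ht₀.2])
      rw [NNReal.coe_zero, sub_zero, NNReal.coe_mul, Real.coe_toNNReal _ hT]
      exact mul_le_mul_of_nonneg_left this L.2
  exact hpl.exists_eq_forall_mem_Icc_hasDerivWithinAt₀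

/-- A clamped curve started on the level `eta 0` stays between that level and `eta`. -/
lemma IsClampedCurve.mem_Icc_eta (h : M.IsFundamentalPair ψ φ) {ε : ℝ} {y : ℝ → ℝ}
    (hε : ε ∈ Ioc 0 M.horizon) (hy : M.IsClampedCurve ψ φ ε y) (hy0 : y ε = M.eta ψ φ 0) :
    ∀ m ∈ Icc ε M.horizon, y m ∈ Icc (M.eta ψ φ 0) (M.eta ψ φ m) := by
  have hI : ∀ t ∈ Ioo ε M.horizon, t ∈ Ioc 0 M.horizon := fun t ht =>
    ⟨hε.1.trans ht.1, ht.2.le⟩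
  have hle : ∀ m ∈ Icc ε M.horizon, y m ≤ M.eta ψ φ m := by
    refine le_eta_of_deriv_nonpos h hε.1.le hy.continuousOn ?_ fun t ht hlt => ?_
    · rw [hy0]
      exact (strictMonoOn_eta h).monotoneOn ⟨le_rfl, xbar_pos.le⟩ (mem_Icc_xbar hε) hε.1.le
    · refine ⟨_, ?_, hy.hasDerivAt ht⟩
      have hη := mem_Icc_xbar (hI t ht)
      refine E_nonpos h (hI t ht) ?_
      rw [coe_projIcc]
      exact le_max_of_le_right (le_min (eta_le_xbar h hη) hlt.le)
  have hmono : MonotoneOn y (Icc ε M.horizon) := by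
    refine monotoneOn_Icc_of_hasDerivAt hy.continuousOn (fun t ht => hy.hasDerivAt ht)
      fun t ht => E_nonneg h (hI t ht) (projIcc 0 M.xbar xbar_pos.le (y t)).2.1 ?_
    rw [coe_projIcc]
    exact max_le (eta_nonneg h (mem_Icc_xbar (hI t ht)))
      (min_le_of_right_le (hle t ⟨ht.1.le, ht.2.le⟩))
  intro m hm
  refine ⟨?_, hle m hm⟩
  rw [← hy0]
  exact hmono ⟨le_rfl, hε.2⟩ hm hm.1

/-- The singular Cauchy problem has a solution: curves started on the level `eta 0` at times
tending to `0` have terminal values with a cluster point `β`, and the backward solution from `β` is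
their limit. -/
lemma exists_solution (h : M.IsFundamentalPair ψ φ) :
    ∃ b : ℝ → ℝ, b 0 = M.eta ψ φ 0 ∧
      (∀ m ∈ Ioc 0 M.horizon, b m ∈ Icc (M.eta ψ φ 0) (M.eta ψ φ m)) ∧
      (∀ m, M.horizon ≤ m → b m = b M.horizon) ∧
      ∀ ε ∈ Ioc 0 M.horizon, ∀ m ∈ Icc ε M.horizon,
        HasDerivWithinAt b (M.E ψ φ (b m) m) (Icc ε M.horizon) m := by
  have hT := horizon_pos (M := M)
  have hTmem : ∀ {ε : ℝ}, ε ∈ Ioc 0 M.horizon → M.horizon ∈ Icc ε M.horizon :=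
    fun hε => ⟨hε.2, le_rfl⟩
  set e : ℕ → ℝ := fun n => M.horizon / (n + 1) with he
  have heI : ∀ n, e n ∈ Ioc 0 M.horizon := fun n =>
    ⟨by positivity, div_le_self hT.le (by simp)⟩
  have helim : Tendsto e atTop (𝓝 0) := by
    simpa [he, div_eq_mul_inv] using
      (tendsto_one_div_add_atTop_nhds_zero_nat (𝕜 := ℝ)).const_mul M.horizon
  choose y hy0 hy using fun n =>
    exists_isClampedCurve h (heI n).1 ⟨le_rfl, (heI n).2⟩ (M.eta ψ φ 0)
  have hyη := fun n => (hy n).mem_Icc_eta h (heI n) (hy0 n)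
  obtain ⟨β, -, s, hs, hβ⟩ := (isCompact_Icc (a := M.eta ψ φ 0)
    (b := M.eta ψ φ M.horizon)).tendsto_subseq fun n => hyη n M.horizon (hTmem (heI n))
  have hz' : ∀ ε, ε ∈ Ioc 0 M.horizon → ∃ z : ℝ → ℝ, z M.horizon = β ∧ M.IsClampedCurve ψ φ ε z :=
    fun ε hε => exists_isClampedCurve h hε.1 (hTmem hε) β
  choose! z hzβ hz using hz'
  -- Backward continuous dependence: near terminal values give near curves on `[ε, horizon]`.
  have hlim : ∀ ε ∈ Ioc 0 M.horizon, ∀ m ∈ Icc ε M.horizon,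
      (∀ᶠ n in atTop, m ∈ Icc (e (s n)) M.horizon) ∧
      Tendsto (fun n => y (s n) m) atTop (𝓝 (z ε m)) := by
    intro ε hε m hm
    have hev : ∀ᶠ n in atTop, e (s n) < ε :=
      (helim.comp hs.tendsto_atTop).eventually_lt_const hε.1
    refine ⟨hev.mono fun n hn => ⟨hn.le.trans hm.1, hm.2⟩, ?_⟩
    obtain ⟨L, K, hLK⟩ := exists_bound_clampedE h hε.1
    have hbd : ∀ᶠ n in atTop, (y (s n) m - z ε m) ^ 2 ≤
        (y (s n) M.horizon - β) ^ 2 * Real.exp (2 * K * (M.horizon - m)) := by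
      filter_upwards [hev] with n hn
      rw [← hzβ ε hε]
      have h1 : e (s n) ≤ m := hn.le.trans hm.1
      exact (sq_sub_le_of_deriv_sub_le hm.2
        ((hy (s n)).continuousOn.mono (Icc_subset_Icc_left h1))
        ((hz ε hε).continuousOn.mono (Icc_subset_Icc_left hm.1))
        (fun t ht => (hy (s n)).hasDerivAt ⟨h1.trans_lt ht.1, ht.2⟩)
        (fun t ht => (hz ε hε).hasDerivAt ⟨hm.1.trans_lt ht.1, ht.2⟩)
        (fun t ht => (hLK t ⟨hm.1.trans ht.1.le, ht.2.le⟩).2 _ _)).1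
    have h0 : Tendsto (fun n => (y (s n) M.horizon - β) ^ 2 *
        Real.exp (2 * K * (M.horizon - m))) atTop (𝓝 0) := by
      have := ((hβ.sub_const β).pow 2).mul_const (Real.exp (2 * K * (M.horizon - m)))
      simpa using this
    have hsq := squeeze_zero' (Eventually.of_forall fun n => sq_nonneg (y (s n) m - z ε m)) hbd h0
    have habs : Tendsto (fun n => |y (s n) m - z ε m|) atTop (𝓝 0) := by
      simpa [Real.sqrt_sq_eq_abs] using hsq.sqrt
    exact tendsto_sub_nhds_zero_iff.1 ((tendsto_zero_iff_abs_tendsto_zero _).2 habs)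
  -- The backward solutions on different intervals agree, being limits of the same sequence; they
  -- glue to the function `m ↦ z m m`.
  have hdiag : ∀ ε ∈ Ioc 0 M.horizon, ∀ m ∈ Icc ε M.horizon, z m m = z ε m := fun ε hε m hm =>
    tendsto_nhds_unique (hlim m ⟨hε.1.trans_le hm.1, hm.2⟩ m ⟨le_rfl, hm.2⟩).2 (hlim ε hε m hm).2
  have hzη : ∀ m ∈ Ioc 0 M.horizon, z m m ∈ Icc (M.eta ψ φ 0) (M.eta ψ φ m) := by
    intro m hm
    obtain ⟨hev, hl⟩ := hlim m hm m ⟨le_rfl, hm.2⟩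
    exact isClosed_Icc.mem_of_tendsto hl (hev.mono fun n hn => hyη (s n) m hn)
  set b : ℝ → ℝ := fun m => if m ≤ 0 then M.eta ψ φ 0 else if m ≤ M.horizon then z m m else β
    with hbdef
  have hb : ∀ m ∈ Ioc 0 M.horizon, b m = z m m := fun m hm => by
    simp only [hbdef, if_neg (not_le.2 hm.1), if_pos hm.2]
  have hbT : b M.horizon = β := by
    rw [hb _ ⟨hT, le_rfl⟩, hzβ _ ⟨hT, le_rfl⟩]
  refine ⟨b, by simp [hbdef], fun m hm => hb m hm ▸ hzη m hm, fun m hm => ?_, ?_⟩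
  · rcases hm.eq_or_lt with rfl | hlt
    · rfl
    · rw [hbT]
      simp only [hbdef, if_neg (not_le.2 (hT.trans hlt)), if_neg (not_le.2 hlt)]
  · intro ε hε m hm
    have hbz : ∀ t ∈ Icc ε M.horizon, b t = z ε t := fun t ht => by
      rw [hb t ⟨hε.1.trans_le ht.1, ht.2⟩, hdiag ε hε t ht]
    have hm' : m ∈ Ioc 0 M.horizon := ⟨hε.1.trans_le hm.1, hm.2⟩
    have hmem : z ε m ∈ Icc 0 M.xbar := by
      have := hzη m hm'
      rw [hdiag ε hε m hm] at this
      exact ⟨(eta_zero_pos h).le.trans this.1, this.2.trans (eta_le_xbar h (mem_Icc_xbar hm'))⟩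
    have := hz ε hε m hm
    rw [clampedE_of_mem hmem, ← hbz m hm] at this
    exact this.congr hbz (hbz m hm)

/-! ### The solution on `[0, xbar]` and its first fixed point -/

/-- If `b` starts above the diagonal and first meets it at `m`, it crosses with slope below `1`:
otherwise `E ≥ 1` on the diagonal before `m`, so by Grönwall `b` would stay above it. -/
lemma E_lt_one_of_first_fixed_point (h : M.IsFundamentalPair ψ φ) {b : ℝ → ℝ}
    (hb : M.IsSolutionToHorizon ψ φ b) {m : ℝ} (hm : m ∈ Ioc 0 M.horizon)
    (hfix : b m = m) (habove : ∀ t ∈ Ico 0 m, t < b t) : M.E ψ φ m m < 1 := by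
  by_contra! hge
  have hm2 : 0 < m / 2 := half_pos hm.1
  have hle : m / 2 ≤ m := half_le_self hm.1.le
  obtain ⟨-, K, -, hK⟩ := boundedLipschitz_E h hm2
  have hg := mul_exp_le_of_deriv_ge (g := fun t => b t - t) (g' := fun t => M.E ψ φ (b t) t - 1)
    (K := K) hle
    ((hb.continuousOn.mono (Icc_subset_Icc hm2.le hm.2)).sub continuousOn_id)
    (fun t ht => (hb.ode t ⟨hm2.trans ht.1, ht.2.trans_le hm.2⟩).sub (hasDerivAt_id t))
    (fun t ht => by
      have ht0 : 0 < t := hm2.trans ht.1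
      have htT : t ≤ M.horizon := ht.2.le.trans hm.2
      have hlt := habove t ⟨ht0.le, ht.2⟩
      have h1 := hK t ⟨ht.1.le, htT⟩ (b t) (hb.mem_Icc h ⟨ht0.le, htT⟩) t
        (mem_Icc_xbar ⟨ht0, htT⟩)
      rw [abs_of_pos (sub_pos.2 hlt)] at h1
      have h2 := E_diag_anti h ⟨ht0, htT⟩ hm ht.2.le
      have h3 := (abs_le.1 h1).1
      linarith)
  simp only [hfix, sub_self, zero_mul] at hg
  have hpos := habove (m / 2) ⟨hm2.le, half_lt_self hm.1⟩
  exact absurd hg (not_le.2 (mul_pos (sub_pos.2 hpos) (Real.exp_pos _)))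

/-- The distance from `b` to `xbar` decays at most exponentially, since `E(xbar,·) ≤ 0`. -/
lemma apply_horizon_lt_xbar (h : M.IsFundamentalPair ψ φ) {b : ℝ → ℝ}
    (hb : M.IsSolutionToHorizon ψ φ b) : b M.horizon < M.xbar := by
  have hT := horizon_pos (M := M)
  have hT2 : 0 < M.horizon / 2 := half_pos hT
  have hle : M.horizon / 2 ≤ M.horizon := half_le_self hT.le
  obtain ⟨-, K, -, hK⟩ := boundedLipschitz_E h hT2
  have hg := mul_exp_le_of_deriv_ge (g := fun t => M.xbar - b t)
    (g' := fun t => 0 - M.E ψ φ (b t) t) (K := K) hle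
    (continuousOn_const.sub (hb.continuousOn.mono (Icc_subset_Icc_left hT2.le)))
    (fun t ht => (hasDerivAt_const t M.xbar).sub (hb.ode t ⟨hT2.trans ht.1, ht.2⟩))
    (fun t ht => by
      have ht0 : 0 < t := hT2.trans ht.1
      have hbt := hb.mem_Icc h ⟨ht0.le, ht.2.le⟩
      have h1 := hK t ⟨ht.1.le, ht.2.le⟩ M.xbar ⟨xbar_pos.le, le_rfl⟩ (b t) hbt
      rw [abs_of_nonneg (sub_nonneg.2 hbt.2)] at h1
      have htI : t ∈ Ioc 0 M.horizon := ⟨ht0, ht.2.le⟩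
      have h2 := E_nonpos h htI (eta_le_xbar h (mem_Icc_xbar htI))
      have h3 := (abs_le.1 h1).1
      linarith)
  have hpos : b (M.horizon / 2) < M.xbar :=
    (hb.le_eta h _ ⟨hT2.le, hle⟩).trans_lt
      (eta_lt_xbar h ⟨hT2.le, (half_lt_self hT).trans_le horizon_le_xbar⟩)
  have := (mul_pos (sub_pos.2 hpos) (Real.exp_pos _)).trans_le hg
  exact sub_pos.1 (pos_of_mul_pos_left this (Real.exp_pos _).le)

lemma IsCauchySolution.isSolutionToHorizon {b : ℝ → ℝ} (hb : M.IsCauchySolution ψ φ b) :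
    M.IsSolutionToHorizon ψ φ b where
  continuousOn := hb.continuousOn.mono (Icc_subset_Icc_right horizon_le_xbar)
  nonneg _ hm := (hb.mapsTo ⟨hm.1, hm.2.trans horizon_le_xbar⟩).1
  initial := hb.initial
  ode := hb.ode

lemma IsCauchySolution.eqOn (h : M.IsFundamentalPair ψ φ) {b₁ b₂ : ℝ → ℝ}
    (hb₁ : M.IsCauchySolution ψ φ b₁) (hb₂ : M.IsCauchySolution ψ φ b₂) :
    EqOn b₁ b₂ (Icc 0 M.xbar) := by
  have heq := hb₁.isSolutionToHorizon.eqOn h hb₂.isSolutionToHorizon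
  intro m hm
  rcases le_or_gt m M.horizon with hle | hlt
  · exact heq ⟨hm.1, hle⟩
  · rw [hb₁.const m hm hlt, hb₂.const m hm hlt]
    exact heq ⟨horizon_pos.le, le_rfl⟩

/-- A solution of the singular Cauchy problem, constant beyond the horizon on the whole line, with
its one-sided derivative at the horizon. -/
lemma exists_isCauchySolution (h : M.IsFundamentalPair ψ φ) :
    ∃ b : ℝ → ℝ, M.IsCauchySolution ψ φ b ∧ (∀ m, M.horizon ≤ m → b m = b M.horizon) ∧
      HasDerivWithinAt b (M.E ψ φ (b M.horizon) M.horizon) (Iic M.horizon) M.horizon := by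
  obtain ⟨b, hb0, hbη, hconst, hd⟩ := exists_solution h
  have hT := horizon_pos (M := M)
  have hode : ∀ m ∈ Ioo 0 M.horizon, HasDerivAt b (M.E ψ φ (b m) m) m := fun m hm =>
    (hd (m / 2) ⟨half_pos hm.1, (half_le_self hm.1.le).trans hm.2.le⟩ m
      ⟨half_le_self hm.1.le, hm.2.le⟩).hasDerivAt (Icc_mem_nhds (half_lt_self hm.1) hm.2)
  have hleft : HasDerivWithinAt b (M.E ψ φ (b M.horizon) M.horizon) (Iic M.horizon) M.horizon :=
    (hd (M.horizon / 2) ⟨half_pos hT, half_le_self hT.le⟩ M.horizon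
      ⟨half_le_self hT.le, le_rfl⟩).mono_of_mem_nhdsWithin (Icc_mem_nhdsLE (half_lt_self hT))
  have hnn : ∀ m ∈ Icc 0 M.horizon, 0 ≤ b m := by
    intro m hm
    rcases hm.1.eq_or_lt with rfl | hpos
    · exact hb0 ▸ (eta_zero_pos h).le
    · exact (eta_zero_pos h).le.trans (hbη m ⟨hpos, hm.2⟩).1
  have hcont : ContinuousOn b (Ici 0) := by
    intro m hm
    rcases (mem_Ici.1 hm).eq_or_lt with rfl | hpos
    · rw [ContinuousWithinAt, hb0, tendsto_order]
      have hsmall : ∀ᶠ t in 𝓝[≥] (0 : ℝ), t ∈ Icc 0 M.horizon := Icc_mem_nhdsGE hT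
      refine ⟨fun x hx => ?_, fun x hx => ?_⟩
      · filter_upwards [hsmall] with t ht
        rcases ht.1.eq_or_lt with rfl | hpos
        · rwa [hb0]
        · exact hx.trans_le (hbη t ⟨hpos, ht.2⟩).1
      · filter_upwards [hsmall, eventually_eta_lt h hx] with t ht hlt
        rcases ht.1.eq_or_lt with rfl | hpos
        · rwa [hb0]
        · exact (hbη t ⟨hpos, ht.2⟩).2.trans_lt hlt
    · refine ContinuousAt.continuousWithinAt ?_
      rcases lt_trichotomy m M.horizon with hlt | rfl | hgt
      · exact (hode m ⟨hpos, hlt⟩).continuousAt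
      · rw [continuousAt_iff_continuous_left_right]
        have hc : ContinuousWithinAt (fun _ => b M.horizon) (Ici M.horizon) M.horizon :=
          continuousWithinAt_const
        exact ⟨hleft.continuousWithinAt, hc.congr (fun t ht => hconst t ht) rfl⟩
      · refine (continuousAt_const (y := b M.horizon)).congr ?_
        filter_upwards [Ioi_mem_nhds hgt] with t ht using (hconst t (le_of_lt ht)).symm
  refine ⟨b, ⟨?_, hcont.mono Icc_subset_Ici_self, ?_, hb0, hode, fun m _ hlt => hconst m hlt.le⟩,
    hconst, hleft⟩
  · have hmem : ∀ m ∈ Icc 0 M.horizon, b m ∈ Icc 0 M.xbar := by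
      intro m hm
      refine ⟨hnn m hm, ?_⟩
      rcases hm.1.eq_or_lt with rfl | hpos
      · exact hb0 ▸ eta_le_xbar h ⟨le_rfl, xbar_pos.le⟩
      · exact (hbη m ⟨hpos, hm.2⟩).2.trans (eta_le_xbar h (mem_Icc_xbar ⟨hpos, hm.2⟩))
    intro m hm
    rcases le_or_gt m M.horizon with hle | hlt
    · exact hmem m ⟨hm.1, hle⟩
    · rw [hconst m hlt.le]
      exact hmem _ ⟨hT.le, le_rfl⟩
  · change ContDiffOn ℝ 1 b (Ioo 0 M.horizon)
    rw [show (1 : WithTop ℕ∞) = 0 + 1 by simp, contDiffOn_succ_iff_deriv_of_isOpen isOpen_Ioo]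
    refine ⟨fun m hm => (hode m hm).differentiableAt.differentiableWithinAt, by simp, ?_⟩
    rw [contDiffOn_zero]
    refine (continuousOn_E_comp h (b := b) Ioo_subset_Ioc_self
      (hcont.mono fun m hm => le_of_lt hm.1) fun m hm => hnn m ⟨hm.1.le, hm.2.le⟩).congr ?_
    exact fun m hm => (hode m hm).deriv

/-- The first fixed point of the solution, with the one-sided slopes there. The kink at the horizon
matters only if the horizon is `ybar`, since the fixed point lies below `xbar`. -/
lemma IsCauchySolution.exists_first_fixed_point (h : M.IsFundamentalPair ψ φ) {b : ℝ → ℝ}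
    (hb : M.IsCauchySolution ψ φ b) (hconst : ∀ m, M.horizon ≤ m → b m = b M.horizon)
    (hleft : HasDerivWithinAt b (M.E ψ φ (b M.horizon) M.horizon) (Iic M.horizon) M.horizon) :
    ∃ mbar : ℝ,
      IsLeast {m : ℝ | m ∈ Icc 0 M.xbar ∧ b m = m} mbar ∧
      mbar ∈ Ioo 0 M.xbar ∧
      ∃ dl dr : ℝ,
        HasDerivWithinAt b dl (Iic mbar) mbar ∧
        HasDerivWithinAt b dr (Ici mbar) mbar ∧
        dl < 1 ∧ dr < 1 ∧
        (mbar ≠ M.ybar → dl = dr) := by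
  have hbT := hb.isSolutionToHorizon
  have hx := xbar_pos (M := M)
  have hb0 : 0 < b 0 := hb.initial ▸ eta_zero_pos h
  have hbx : b M.xbar < M.xbar := by
    rw [hconst _ horizon_le_xbar]
    exact apply_horizon_lt_xbar h hbT
  -- `b` crosses the diagonal before any point where it is not above it.
  have hcross : ∀ m ∈ Icc 0 M.xbar, b m ≤ m → ∃ z ∈ Icc 0 m, b z = z := by
    intro m hm hle
    obtain ⟨z, hz, hz0⟩ := intermediate_value_Icc' hm.1 (f := fun t => b t - t)
      ((hb.continuousOn.mono (Icc_subset_Icc_right hm.2)).sub continuousOn_id)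
      (show (0 : ℝ) ∈ Icc (b m - m) (b 0 - 0) from ⟨sub_nonpos.2 hle, by simpa using hb0.le⟩)
    exact ⟨z, hz, sub_eq_zero.1 hz0⟩
  obtain ⟨mbar, hleast⟩ : ∃ mbar, IsLeast {m : ℝ | m ∈ Icc 0 M.xbar ∧ b m = m} mbar := by
    have hclosed : IsClosed (Icc 0 M.xbar ∩ (fun t => b t - t) ⁻¹' {0}) :=
      (hb.continuousOn.sub continuousOn_id).preimage_isClosed_of_isClosed isClosed_Icc
        isClosed_singleton
    have hset : {m : ℝ | m ∈ Icc 0 M.xbar ∧ b m = m} =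
        Icc 0 M.xbar ∩ (fun t => b t - t) ⁻¹' {0} := by
      ext m
      simp [sub_eq_zero]
    obtain ⟨z, hz, hz0⟩ := hcross M.xbar ⟨hx.le, le_rfl⟩ hbx.le
    refine IsCompact.exists_isLeast ?_ ⟨z, hz, hz0⟩
    rw [hset]
    exact isCompact_Icc.of_isClosed_subset hclosed inter_subset_left
  obtain ⟨⟨hmI, hmfix⟩, hlow⟩ := id hleast
  have hm0 : 0 < mbar := hmI.1.lt_of_ne fun he => by
    rw [← he] at hmfix
    exact hb0.ne' hmfix
  have hmx : mbar < M.xbar := hmI.2.lt_of_ne fun he => by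
    rw [he] at hmfix
    exact hbx.ne hmfix
  have habove : ∀ t ∈ Ico 0 mbar, t < b t := by
    intro t ht
    by_contra! hle
    have htx : t ≤ M.xbar := ht.2.le.trans hmI.2
    obtain ⟨z, hz, hz0⟩ := hcross t ⟨ht.1, htx⟩ hle
    exact absurd (hlow ⟨⟨hz.1, hz.2.trans htx⟩, hz0⟩) (not_le.2 (hz.2.trans_lt ht.2))
  refine ⟨mbar, hleast, ⟨hm0, hmx⟩, ?_⟩
  rcases lt_trichotomy mbar M.horizon with hlt | heq | hgt
  · have hE := E_lt_one_of_first_fixed_point h hbT ⟨hm0, hlt.le⟩ hmfix habove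
    have hd := hbT.ode mbar ⟨hm0, hlt⟩
    rw [hmfix] at hd
    exact ⟨_, _, hd.hasDerivWithinAt, hd.hasDerivWithinAt, hE, hE, fun _ => rfl⟩
  · have hE := E_lt_one_of_first_fixed_point h hbT ⟨hm0, heq.le⟩ hmfix habove
    rw [← heq, hmfix] at hleft
    refine ⟨_, 0, hleft, ?_, hE, zero_lt_one, fun hne => ?_⟩
    · refine (hasDerivWithinAt_const mbar (Ici mbar) (b mbar)).congr (fun t ht => ?_) rfl
      rw [hconst t (heq ▸ ht), heq]
    · -- Below `xbar`, the horizon can only be `ybar`.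
      rcases min_choice M.xbar M.ybar with hc | hc
      · exact absurd (heq.trans hc) hmx.ne
      · exact absurd (heq.trans hc) hne
  · have hd : HasDerivAt b 0 mbar := by
      refine (hasDerivAt_const mbar (b M.horizon)).congr_of_eventuallyEq ?_
      filter_upwards [Ioi_mem_nhds hgt] with t ht using hconst t (le_of_lt ht)
    exact ⟨0, 0, hd.hasDerivWithinAt, hd.hasDerivWithinAt, zero_lt_one, zero_lt_one, fun _ => rfl⟩

/-- A solution that is constant beyond the horizon inherits monotonicity and the bound by `eta`
from `[0, xbar ∧ ybar]`. -/
lemma IsCauchySolution.monotoneOn_and_le_eta (h : M.IsFundamentalPair ψ φ) {b : ℝ → ℝ}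
    (hb : M.IsCauchySolution ψ φ b) (hconst : ∀ m, M.horizon ≤ m → b m = b M.horizon) :
    MonotoneOn b (Icc 0 M.xbar) ∧ ∀ m ∈ Icc 0 M.xbar, b m ≤ M.eta ψ φ m := by
  have hbT := hb.isSolutionToHorizon
  have hmin : ∀ m, b m = b (min m M.horizon) := by
    intro m
    rcases le_total m M.horizon with hle | hle
    · rw [min_eq_left hle]
    · rw [min_eq_right hle, hconst m hle]
  have hclip : ∀ m ∈ Icc 0 M.xbar, min m M.horizon ∈ Icc 0 M.horizon := fun m hm =>
    ⟨le_min hm.1 horizon_pos.le, min_le_right _ _⟩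
  constructor
  · intro m hm n hn hmn
    rw [hmin m, hmin n]
    exact hbT.monotoneOn h (hclip m hm) (hclip n hn) (min_le_min_right _ hmn)
  · intro m hm
    rw [hmin m]
    exact (hbT.le_eta h _ (hclip m hm)).trans ((strictMonoOn_eta h).monotoneOn
      ⟨(hclip m hm).1, (min_le_left _ _).trans hm.2⟩ hm (min_le_left _ _))

end Model

end Tipping

theorem mainTheorem5 (M : Tipping.Model) (ψ φ : ℝ → ℝ) (hψφ : M.IsFundamentalPair ψ φ) :
    ∃ b : ℝ → ℝ,
      M.IsCauchySolution ψ φ b ∧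
      (∀ b' : ℝ → ℝ, M.IsCauchySolution ψ φ b' → Set.EqOn b' b (Set.Icc 0 M.xbar)) ∧
      MonotoneOn b (Set.Icc 0 M.xbar) ∧
      (∀ m ∈ Set.Icc 0 M.xbar, b m ≤ M.eta ψ φ m) ∧
      ∃ mbar : ℝ,
        IsLeast {m : ℝ | m ∈ Set.Icc 0 M.xbar ∧ b m = m} mbar ∧
        mbar ∈ Set.Ioo 0 M.xbar ∧
        ∃ dl dr : ℝ,
          HasDerivWithinAt b dl (Set.Iic mbar) mbar ∧
          HasDerivWithinAt b dr (Set.Ici mbar) mbar ∧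
          dl < 1 ∧ dr < 1 ∧
          (mbar ≠ M.ybar → dl = dr) := by
  obtain ⟨b, hb, hconst, hleft⟩ := Tipping.Model.exists_isCauchySolution hψφ
  obtain ⟨hmono, hle⟩ := hb.monotoneOn_and_le_eta hψφ hconst
  exact ⟨b, hb, fun b' hb' => hb'.eqOn hψφ hb, hmono, hle,
    hb.exists_first_fixed_point hψφ hconst hleft⟩
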